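/- Throughout, a hypergraph is finite, with an edge set that is a set of subsets of its vertex set. It is $r$-uniform if every edge has exactly $r$ vertices. A cycle is a sequence of $k\ge 2$ distinct vertices $x_0,\dots,x_{k-1}$ and $k$ distinct edges $e_0,\dots,e_{k-1}$ with $x_i,x_{i+1}\in e_i$ (indices modulo $k$). An $r$-uniform supertree is a connected $r$-uniform hypergraph with at least one vertex and without cycles. The adjacency tensor of an $r$-uniform hypergraph $\mathcal F$ with vertex set $V$ has entries $a_{i_1\cdots i_r}=\frac1{(r-1)!}$ if $\{i_1,\dots,i_r\}$ is an edge and $0$ otherwise. A number $\lambda\in\mathbb C$ is an eigenvalue if there is a nonzero $x\in\mathbb C^{V}$ with $\sum_{i_2,\dots,i_r\in V}a_{i i_2\cdots i_r}x_{i_2}\cdots x_{i_r}=\lambda x_i^{r-1}$ for all $i\in V$. The spectral radius $\rho(\mathcal F)$ is the maximum modulus of the eigenvalues. If $\mathcal F$ has $n$ vertices and $m(\mathcal F,k)$ denotes the number of sets of $k$ pairwise disjoint edges of $\mathcal F$, its matching polynomial is $\varphi(\mathcal F,x)=\sum_{k\ge0}(-1)^k m(\mathcal F,k)x^{n-kr}$.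 The matching energy $ME(\mathcal F)$ is the sum of the absolute values of all complex roots of $\varphi(\mathcal F,x)$, counted with multiplicity. Let $r\ge3$ and $m\ge1$ be integers, let $\mathcal G$ and $\mathcal H$ be $r$-uniform supertrees, and let $u\in V(\mathcal G)$ and $v\in V(\mathcal H)$. Let $\mathcal G_u\cdot m\mathcal H_v$ be the hypergraph obtained from the disjoint union of $\mathcal G$ and $m$ copies of $\mathcal H$ by adding $m(r-2)$ new vertices and $m$ new edges $e_1,\dots,e_m$, where $e_i$ consists of $u$, of the vertex $v$ of the $i$-th copy of $\mathcal H$, and of $r-2$ of the new vertices, no new vertex lying in two of the edges $e_i$. Define $\mathcal H_v\cdot m\mathcal G_u$ in the same way with the roles of $(\mathcal G,u)$ and $(\mathcal H,v)$ exchanged. Write $\cup$ for disjoint union and $(m-1)\mathcal F$ for the disjoint union of $m-1$ copies of $\mathcal F$. Then (i) $\rho\big((\mathcal G_u\cdot m\mathcal H_v)\cup(m-1)\mathcal G\big)=\rho\big((\mathcal H_v\cdot m\mathcal G_u)\cup(m-1)\mathcal H\big)$ and $\rho(\mathcal G_u\cdot m\mathcal H_v)=\rho(\mathcal H_v\cdot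 m\mathcal G_u)$; (ii) $ME\big((\mathcal G_u\cdot m\mathcal H_v)\cup(m-1)\mathcal G\big)=ME\big((\mathcal H_v\cdot m\mathcal G_u)\cup(m-1)\mathcal H\big)$. -/

import Mathlib

/-- A real tensor (hypermatrix) of order `r` and with index set `ι`. The entry
`a_{i i₂ … i_r}` is written `A i f` with `f = (i₂, …, i_r)`. -/
abbrev RealTensor (r : ℕ) (ι : Type*) : Type _ := ι → (Fin (r - 1) → ι) → ℝ

namespace RealTensor

variable {r : ℕ} {ι : Type*}

/-- `(A x)_i = ∑_{i₂, …, i_r} a_{i i₂ … i_r} x_{i₂} ⋯ x_{i_r}` (for a finite index set). -/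
noncomputable def apply (A : RealTensor r ι) (x : ι → ℂ) (i : ι) : ℂ :=
  ∑ᶠ f : Fin (r - 1) → ι, (A i f : ℂ) * ∏ j, x (f j)

/-- `μ ∈ ℂ` is an eigenvalue of `A` if `A x = μ x^{[r-1]}` for some nonzero complex vector `x`. -/
def IsEigenvalue (A : RealTensor r ι) (μ : ℂ) : Prop :=
  ∃ x : ι → ℂ, x ≠ 0 ∧ ∀ i, A.apply x i = μ * x i ^ (r - 1)

/-- The spectral radius: the maximum modulus of the eigenvalues. -/
noncomputable def spectralRadius (A : RealTensor r ι) : ℝ :=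
  sSup {t : ℝ | ∃ μ : ℂ, A.IsEigenvalue μ ∧ t = ‖μ‖}

/-- Over a finite index set the supremum is a maximum as soon as there is an eigenvalue. -/
theorem isGreatest_spectralRadius [Finite ι] (A : RealTensor r ι)
    (h : ∃ μ : ℂ, A.IsEigenvalue μ) :
    IsGreatest {t : ℝ | ∃ μ : ℂ, A.IsEigenvalue μ ∧ t = ‖μ‖} A.spectralRadius := by
  classical
  have := Fintype.ofFinite ι
  have happ : ∀ x i, A.apply x i = ∑ f : Fin (r - 1) → ι, (A i f : ℂ) * ∏ j, x (f j) :=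
    fun x i => finsum_eq_sum_of_fintype _
  set Z : Set (ℂ × (ι → ℂ)) :=
    {p | ‖p.2‖ = 1 ∧ ∀ i, A.apply p.2 i = p.1 * p.2 i ^ (r - 1)} with hZ
  have hclosed : IsClosed Z := by
    rw [hZ, Set.ofPred_and]
    refine IsClosed.inter (isClosed_eq (by fun_prop) continuous_const) ?_
    rw [Set.ofPred_forall]
    refine isClosed_iInter fun i => isClosed_eq ?_ (by fun_prop)
    simp only [happ]
    fun_prop
  set C : ℝ := ∑ i, ∑ f : Fin (r - 1) → ι, |A i f| with hC
  have hbd : Z ⊆ Metric.closedBall (0 : ℂ) C ×ˢ Metric.sphere (0 : ι → ℂ) 1 := by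
    rintro ⟨μ, x⟩ ⟨hx, he⟩
    simp only at hx he
    refine ⟨?_, by simpa using hx⟩
    have hne : Nonempty ι := by
      by_contra hn
      rw [not_nonempty_iff] at hn
      have : x = 0 := Subsingleton.elim _ _
      simp [this] at hx
    obtain ⟨i, hi⟩ := (Finite.exists_max fun i => ‖x i‖)
    have hi1 : ‖x i‖ = 1 := by
      apply le_antisymm (hx ▸ norm_le_pi_norm x i)
      rw [← hx]
      exact (pi_norm_le_iff_of_nonempty x).2 hi
    have h1 : ‖μ‖ = ‖A.apply x i‖ := by rw [he i]; simp [hi1]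
    simp only [mem_closedBall_zero_iff, h1, happ]
    calc ‖∑ f : Fin (r - 1) → ι, (A i f : ℂ) * ∏ j, x (f j)‖
        ≤ ∑ f : Fin (r - 1) → ι, |A i f| := by
          refine norm_sum_le_of_le _ fun f _ => ?_
          rw [norm_mul, norm_prod, Complex.norm_real, Real.norm_eq_abs]
          refine mul_le_of_le_one_right (abs_nonneg _) ?_
          exact Finset.prod_le_one (fun _ _ => norm_nonneg _)
            fun j _ => hx ▸ norm_le_pi_norm x (f j)
      _ ≤ C := Finset.single_le_sum (f := fun i => ∑ f : Fin (r - 1) → ι, |A i f|)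
          (fun i _ => Finset.sum_nonneg fun _ _ => abs_nonneg _) (Finset.mem_univ i)
  have hcomp : IsCompact Z :=
    ((isCompact_closedBall _ _).prod (isCompact_sphere _ _)).of_isClosed_subset hclosed hbd
  have himg : {t : ℝ | ∃ μ : ℂ, A.IsEigenvalue μ ∧ t = ‖μ‖} = (fun p => ‖p.1‖) '' Z := by
    ext t
    constructor
    · rintro ⟨μ, ⟨x, hx, he⟩, rfl⟩
      have hn : (‖x‖ : ℂ) ≠ 0 := by simpa using hx
      refine ⟨(μ, (‖x‖ : ℂ)⁻¹ • x), ⟨?_, fun i => ?_⟩, rfl⟩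
      · rw [norm_smul, norm_inv, Complex.norm_real, norm_norm]
        exact inv_mul_cancel₀ (by simpa using hx)
      · have := he i
        rw [happ] at this ⊢
        simp only [Pi.smul_apply, smul_eq_mul, Finset.prod_mul_distrib, Finset.prod_const,
          Finset.card_univ, Fintype.card_fin, mul_pow]
        rw [mul_left_comm μ, ← this, Finset.mul_sum]
        exact Finset.sum_congr rfl fun f _ => by ring
    · rintro ⟨⟨μ, x⟩, ⟨hx, he⟩, rfl⟩
      refine ⟨μ, ⟨x, ?_, he⟩, rfl⟩
      rintro rfl
      simp at hx
  obtain ⟨μ, hμ⟩ := h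
  have hne : ((fun p : ℂ × (ι → ℂ) => ‖p.1‖) '' Z).Nonempty := himg ▸ ⟨‖μ‖, μ, hμ, rfl⟩
  rw [spectralRadius, himg]
  exact (hcomp.image (by fun_prop)).isGreatest_sSup hne

end RealTensor

namespace Hypergraph

variable {α β : Type*}

/-- Every edge has exactly `r` vertices. -/
def IsUniform (G : Hypergraph α) (r : ℕ) : Prop :=
  ∀ e ∈ G.edgeSet, e.ncard = r

/-- There is a vertex, and any two vertices are joined by a walk. -/
def IsConnected (G : Hypergraph α) : Prop :=
  G.vertexSet.Nonempty ∧
    ∀ x ∈ G.vertexSet, ∀ y ∈ G.vertexSet, Relation.ReflTransGen G.Adj x y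

/-- A (Berge) cycle of length `k ≥ 2`: distinct vertices `x₀, …, x_{k-1}` and distinct edges
`e₀, …, e_{k-1}` such that `e_i` contains `x_i` and `x_{i+1}`, with indices taken cyclically. -/
def HasCycle (G : Hypergraph α) : Prop :=
  ∃ (k : ℕ) (x : Fin k → α) (e : Fin k → Set α), 2 ≤ k ∧ x.Injective ∧ e.Injective ∧
    ∀ i, e i ∈ G.edgeSet ∧ x i ∈ e i ∧ x (finRotate k i) ∈ e i

/-- An `r`-uniform supertree: a finite connected `r`-uniform hypergraph without cycles. -/
structure IsSupertree (G : Hypergraph α) (r : ℕ) : Prop where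
  finite : G.vertexSet.Finite
  uniform : G.IsUniform r
  connected : G.IsConnected
  acyclic : ¬ G.HasCycle

/-- The disjoint union of two hypergraphs. -/
def disjUnion (G : Hypergraph α) (H : Hypergraph β) : Hypergraph (α ⊕ β) where
  vertexSet := (G.image Sum.inl).vertexSet ∪ (H.image Sum.inr).vertexSet
  edgeSet := (G.image Sum.inl).edgeSet ∪ (H.image Sum.inr).edgeSet
  subset_vertexSet_of_mem_edgeSet' := by
    rintro e (he | he)
    · exact (subset_vertexSet_of_mem_edgeSet he).trans Set.subset_union_left
    · exact (subset_vertexSet_of_mem_edgeSet he).trans Set.subset_union_right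

/-- `mG`: the disjoint union of `m` copies of `G`. -/
def copies (m : ℕ) (G : Hypergraph α) : Hypergraph (Fin m × α) where
  vertexSet := ⋃ i : Fin m, (G.image (Prod.mk i)).vertexSet
  edgeSet := ⋃ i : Fin m, (G.image (Prod.mk i)).edgeSet
  subset_vertexSet_of_mem_edgeSet' := by
    intro e he
    obtain ⟨i, hi⟩ := Set.mem_iUnion.1 he
    exact (subset_vertexSet_of_mem_edgeSet hi).trans
      (Set.subset_iUnion (fun i : Fin m => (G.image (Prod.mk i)).vertexSet) i)

/-- The hypergraph `G_u · mH_v`. Its vertices are those of `G`, of `m` disjoint copies of `H`, and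
`m (r - 2)` further new vertices. Its edges are those of `G` and of the copies of `H`, and
`m` new edges `e_i` of `r` vertices each: `e_i` consists of `u`, of the vertex `v` of the `i`-th
copy of `H`, and of the `r - 2` new vertices with first index `i`. -/
def attach (r m : ℕ) (G : Hypergraph α) (u : G.vertexSet) (H : Hypergraph β) (v : H.vertexSet) :
    Hypergraph (α ⊕ ((Fin m × β) ⊕ (Fin m × Fin (r - 2)))) where
  vertexSet := (G.disjUnion ((copies m H).disjUnion (trivialOn Set.univ))).vertexSet
  edgeSet := (G.disjUnion ((copies m H).disjUnion (trivialOn Set.univ))).edgeSet ∪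
    Set.range fun i : Fin m =>
      insert (Sum.inl u.1) (insert (Sum.inr (Sum.inl (i, v.1)))
        (Set.range fun j : Fin (r - 2) => Sum.inr (Sum.inr (i, j))))
  subset_vertexSet_of_mem_edgeSet' := by
    rintro e (he | ⟨i, rfl⟩)
    · exact subset_vertexSet_of_mem_edgeSet he
    · rintro x (rfl | rfl | ⟨j, rfl⟩)
      · simp [disjUnion]
      · simp [disjUnion, copies]
      · simp [disjUnion]

open Classical in
/-- The adjacency tensor of an `r`-uniform hypergraph: `a_{i₁ … i_r} = 1 / (r - 1)!` if
`{i₁, …, i_r}` is an edge, and `0` otherwise. -/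
noncomputable def adjacencyTensor (r : ℕ) (G : Hypergraph α) : RealTensor r G.vertexSet :=
  fun i f =>
    if insert (i : α) (Set.range fun j => (f j : α)) ∈ G.edgeSet
      then 1 / ((r - 1).factorial : ℝ) else 0

/-- The spectral radius `ρ(G)` of an `r`-uniform hypergraph. -/
noncomputable def spectralRadius (r : ℕ) (G : Hypergraph α) : ℝ :=
  (adjacencyTensor r G).spectralRadius

/-- The number `m(G, k)` of sets of `k` pairwise disjoint edges. -/
noncomputable def numMatchings (G : Hypergraph α) (k : ℕ) : ℕ :=
  Set.ncard {M : Finset (Set α) |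
    (M : Set (Set α)) ⊆ G.edgeSet ∧ M.card = k ∧ (M : Set (Set α)).PairwiseDisjoint id}

/-- The matching polynomial `∑_{k ≥ 0} (-1)^k m(G, k) x^{n - k r}` of an `r`-uniform hypergraph
with `n` vertices; there are no `k`-matchings when `k r > n`. -/
noncomputable def matchingPolynomial (r : ℕ) (G : Hypergraph α) : Polynomial ℂ :=
  ∑ k ∈ Finset.range (G.vertexSet.ncard / r + 1),
    Polynomial.C ((-1) ^ k * (G.numMatchings k : ℂ)) *
      Polynomial.X ^ (G.vertexSet.ncard - k * r)

/-- The matching energy: the sum of the moduli of the complex roots of the matching polynomial,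
counted with multiplicity. -/
noncomputable def matchingEnergy (r : ℕ) (G : Hypergraph α) : ℝ :=
  ((matchingPolynomial r G).roots.map fun z => ‖z‖).sum

/-- For an `r`-uniform hypergraph with `r ≥ 3` and finitely many vertices, at least one, the
spectral radius is a maximum. -/
theorem isGreatest_spectralRadius {r : ℕ} (hr : 3 ≤ r) (G : Hypergraph α)
    (hfin : G.vertexSet.Finite) (hne : G.vertexSet.Nonempty) (hu : G.IsUniform r) :
    IsGreatest {t : ℝ | ∃ μ : ℂ, (adjacencyTensor r G).IsEigenvalue μ ∧ t = ‖μ‖}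
      (spectralRadius r G) := by
  classical
  have : Finite G.vertexSet := hfin
  have := Fintype.ofFinite G.vertexSet
  refine RealTensor.isGreatest_spectralRadius _ ⟨0, ?_⟩
  obtain ⟨a, ha⟩ := hne
  refine ⟨Pi.single ⟨a, ha⟩ 1, by simp, fun i => ?_⟩
  rw [zero_mul, RealTensor.apply, finsum_eq_sum_of_fintype]
  refine Finset.sum_eq_zero fun f _ => ?_
  by_cases he : insert (i : α) (Set.range fun j => (f j : α)) ∈ G.edgeSet
  · have hex : ∃ j, f j ≠ ⟨a, ha⟩ := by
      by_contra! hc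
      have h1 := hu _ he
      have h2 : insert (i : α) (Set.range fun j => (f j : α)) ⊆ {(i : α), a} := by
        rintro x (rfl | ⟨j, rfl⟩)
        · simp
        · simp [hc j]
      have h3 := Set.ncard_le_ncard h2
      have h4 := Set.ncard_insert_le (i : α) {a}
      rw [Set.ncard_singleton] at h4
      omega
    obtain ⟨j, hj⟩ := hex
    rw [Finset.prod_eq_zero (Finset.mem_univ j) (by simp [hj]), mul_zero]
  · simp [adjacencyTensor, he]

end Hypergraph

/-! Spectral part. Join $\mathcal G$ and $\mathcal H$ by a single edge through $u$, $v$ and $r-2$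
new vertices, and give that edge weight $c^{-1}$, where $mc^r=1$. Perron-Frobenius for this
connected weighted hypergraph yields a positive eigenvector $(p,q,z)$ with eigenvalue $l$. Put $p$
on $\mathcal G$, and $cq$, $cz$ on each of the $m$ copies of $\mathcal H$ and on the new vertices:
this is a positive eigenvector of $\mathcal G_u\cdot m\mathcal H_v$ for the same $l$. At $u$ the $m$
unweighted edges contribute $mc^{r-1}=c^{-1}$ times the old term; elsewhere every term scales by
$c^{r-1}$. A positive eigenvector determines the spectral radius, so $\rho=l$. The weighted join
does not distinguish its two sides, hence $\rho(\mathcal H_v\cdot m\mathcal G_u)=l$ as well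
(`IsJoinEigenvector.symm`, `IsJoinEigenvector.spectralRadius_attach`).

Additional copies of $\mathcal G$ do not change the radius: $p$ satisfies $Ap\le l\,p^{[r-1]}$ on
$\mathcal G$ alone, and a positive vector with this inequality already bounds all eigenvalues by $l$
(`spectralRadius_eq_of_le_of_eq`).

Matching part. Let $M$ be the generating function of matchings by size. All new edges contain $u$,
so a matching uses at most one of them, and $M(\mathcal G_u\cdot m\mathcal H_v)=M_{\mathcal
G}M_{\mathcal H}^m+mt\,M_{\mathcal G-u}M_{\mathcal H-v}M_{\mathcal H}^{m-1}$ (`matchSum_attach`).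
Multiplied by $M_{\mathcal G}^{m-1}$ this becomes symmetric in the two sides. The vertex numbers
agree too, so the matching polynomials coincide, and with them the energies. -/

namespace Hypergraph

variable {α β : Type*}

/-! ### Link sums: the eigenvalue equation edge by edge. -/

section LinkSum

variable {R S : Type*} [CommSemiring R] [CommSemiring S]

/-- The weighted sum over the edges `e ∈ E` containing `i` of the product of the entries of `x`
over `e \ {i}`. -/
noncomputable def linkSum (E : Set (Set α)) (w : Set α → R) (x : α → R) (i : α) : R :=
  ∑ᶠ e ∈ {e ∈ E | i ∈ e}, w e * ∏ᶠ j ∈ e \ {i}, x j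

theorem linkSum_union {E F : Set (Set α)} (hE : E.Finite) (hF : F.Finite) (hEF : Disjoint E F)
    (w : Set α → R) (x : α → R) (i : α) :
    linkSum (E ∪ F) w x i = linkSum E w x i + linkSum F w x i := by
  have h : {e ∈ E ∪ F | i ∈ e} = {e ∈ E | i ∈ e} ∪ {e ∈ F | i ∈ e} := by
    ext e; simp [or_and_right]
  rw [linkSum, h, finsum_mem_union]
  · rfl
  · exact hEF.mono (fun _ h => h.1) (fun _ h => h.1)
  · exact hE.subset fun _ h => h.1
  · exact hF.subset fun _ h => h.1

theorem linkSum_image {f : α → β} (hf : f.Injective) (E : Set (Set α)) (w : Set β → R) (x : β → R)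
    (i : α) :
    linkSum (Set.image f '' E) w x (f i) = linkSum E (fun e => w (f '' e)) (x ∘ f) i := by
  have h : {e ∈ Set.image f '' E | f i ∈ e} = Set.image f '' {e ∈ E | i ∈ e} := by
    ext e
    constructor
    · rintro ⟨⟨e, he, rfl⟩, hi⟩
      exact ⟨e, ⟨he, (hf.mem_set_image).1 hi⟩, rfl⟩
    · rintro ⟨e, ⟨he, hi⟩, rfl⟩
      exact ⟨⟨e, he, rfl⟩, (hf.mem_set_image).2 hi⟩
  rw [linkSum, h, finsum_mem_image hf.image_injective.injOn, linkSum]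
  refine finsum_mem_congr rfl fun e _ => ?_
  have : f '' e \ {f i} = f '' (e \ {i}) := by rw [Set.image_sdiff hf, Set.image_singleton]
  rw [this, finprod_mem_image hf.injOn]
  rfl

theorem linkSum_eq_zero {E : Set (Set α)} {i : α} (h : ∀ e ∈ E, i ∉ e) (w : Set α → R)
    (x : α → R) : linkSum E w x i = 0 := by
  have : {e ∈ E | i ∈ e} = ∅ := by ext e; simpa using h e
  rw [linkSum, this, finsum_mem_empty]

theorem map_linkSum {E : Set (Set α)} (hE : E.Finite) (hfin : ∀ e ∈ E, e.Finite) (g : R →+* S)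
    (w : Set α → R) (x : α → R) (i : α) :
    g (linkSum E w x i) = linkSum E (fun e => g (w e)) (fun j => g (x j)) i := by
  have h1 : {e ∈ E | i ∈ e}.Finite := hE.subset fun _ h => h.1
  rw [linkSum, finsum_mem_eq_finite_toFinset_sum _ h1, map_sum, linkSum,
    finsum_mem_eq_finite_toFinset_sum _ h1]
  refine Finset.sum_congr rfl fun e he => ?_
  have h2 : (e \ {i}).Finite := (hfin e ((h1.mem_toFinset).1 he).1).subset Set.sdiff_subset
  rw [map_mul, finprod_mem_eq_finite_toFinset_prod _ h2, map_prod,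
    finprod_mem_eq_finite_toFinset_prod _ h2]

theorem linkSum_smul {E : Set (Set α)} (hE : E.Finite) {r : ℕ} (hr : r ≠ 0)
    (hu : ∀ e ∈ E, e.ncard = r) (w : Set α → R) (c : R) (x : α → R) (i : α) :
    linkSum E w (fun j => c * x j) i = c ^ (r - 1) * linkSum E w x i := by
  have h1 : {e ∈ E | i ∈ e}.Finite := hE.subset fun _ h => h.1
  rw [linkSum, finsum_mem_eq_finite_toFinset_sum _ h1, linkSum,
    finsum_mem_eq_finite_toFinset_sum _ h1, Finset.mul_sum]
  refine Finset.sum_congr rfl fun e he => ?_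
  have he' := (h1.mem_toFinset).1 he
  have hfin : e.Finite := Set.finite_of_ncard_ne_zero (by rw [hu e he'.1]; exact hr)
  have h2 : (e \ {i}).Finite := hfin.subset Set.sdiff_subset
  rw [finprod_mem_eq_finite_toFinset_prod _ h2, finprod_mem_eq_finite_toFinset_prod _ h2,
    Finset.prod_mul_distrib, Finset.prod_const, ← Set.ncard_eq_toFinset_card _ h2,
    Set.ncard_sdiff_singleton_of_mem he'.2, hu e he'.1]
  ring

end LinkSum

theorem linkSum_mono {E : Set (Set α)} (hE : E.Finite) (hfin : ∀ e ∈ E, e.Finite)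
    {w x y : _} (hw : ∀ e ∈ E, (0 : ℝ) ≤ w e) (hx : ∀ e ∈ E, ∀ j ∈ e, (0 : ℝ) ≤ x j)
    (hxy : ∀ e ∈ E, ∀ j ∈ e, x j ≤ y j) (i : α) :
    linkSum E w x i ≤ linkSum E w y i := by
  have h1 : {e ∈ E | i ∈ e}.Finite := hE.subset fun _ h => h.1
  rw [linkSum, finsum_mem_eq_finite_toFinset_sum _ h1, linkSum,
    finsum_mem_eq_finite_toFinset_sum _ h1]
  refine Finset.sum_le_sum fun e he => ?_
  have he' := (h1.mem_toFinset).1 he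
  have h2 : (e \ {i}).Finite := (hfin e he'.1).subset Set.sdiff_subset
  rw [finprod_mem_eq_finite_toFinset_prod _ h2, finprod_mem_eq_finite_toFinset_prod _ h2]
  refine mul_le_mul_of_nonneg_left (Finset.prod_le_prod ?_ ?_) (hw e he'.1)
  · intro j hj; exact hx e he'.1 j ((h2.mem_toFinset).1 hj).1
  · intro j hj; exact hxy e he'.1 j ((h2.mem_toFinset).1 hj).1

theorem norm_linkSum_le {E : Set (Set α)} (hE : E.Finite) (hfin : ∀ e ∈ E, e.Finite)
    (x : α → ℂ) (i : α) :
    ‖linkSum E (fun _ => 1) x i‖ ≤ linkSum E (fun _ => 1) (fun j => ‖x j‖) i := by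
  have h1 : {e ∈ E | i ∈ e}.Finite := hE.subset fun _ h => h.1
  rw [linkSum, finsum_mem_eq_finite_toFinset_sum _ h1, linkSum,
    finsum_mem_eq_finite_toFinset_sum _ h1]
  refine norm_sum_le_of_le _ fun e he => ?_
  have he' := (h1.mem_toFinset).1 he
  have h2 : (e \ {i}).Finite := (hfin e he'.1).subset Set.sdiff_subset
  rw [finprod_mem_eq_finite_toFinset_prod _ h2, finprod_mem_eq_finite_toFinset_prod _ h2,
    one_mul, one_mul, norm_prod]

/-! ### The adjacency tensor via link sums, and a criterion for the spectral radius. -/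

theorem edgeSet_finite {G : Hypergraph α} (hfin : G.vertexSet.Finite) : G.edgeSet.Finite :=
  hfin.finite_subsets.subset fun _ he => subset_vertexSet_of_mem_edgeSet he

/-- The tuples that complete $i$ to $e$ are exactly the $(r-1)!$ orderings of $e\setminus\{i\}$:
covering $r-1$ points with $r-1$ entries leaves no room for repetitions or for $i$ itself. -/
theorem sum_prod_ordering {ι : Type*} [Fintype ι] {r : ℕ} {e : Set ι} (he : e.ncard = r)
    {i : ι} (hi : i ∈ e) (x : ι → ℂ) [DecidablePred fun f : Fin (r - 1) → ι =>
      insert i (Set.range f) = e] :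
    ∑ f : Fin (r - 1) → ι with insert i (Set.range f) = e, ∏ j, x (f j) =
      (r - 1).factorial * ∏ᶠ j ∈ e \ {i}, x j := by
  classical
  have hcard : Fintype.card ↥(e \ {i}) = r - 1 := by
    rw [← Nat.card_eq_fintype_card, Nat.card_coe_set_eq, Set.ncard_sdiff_singleton_of_mem hi, he]
  have hprod : ∏ᶠ j ∈ e \ {i}, x j = ∏ j : ↥(e \ {i}), x j := by
    rw [finprod_mem_eq_toFinset_prod, Finset.prod_set_coe]
  have hσ : Fintype.card (Fin (r - 1) ≃ ↥(e \ {i})) = (r - 1).factorial := by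
    rw [Fintype.card_equiv ((Fintype.equivFinOfCardEq hcard).symm), Fintype.card_fin]
  rw [← hσ, ← Finset.card_univ, ← nsmul_eq_mul, ← Finset.sum_const]
  symm
  refine Finset.sum_bij (fun σ _ => fun j => (σ j : ι)) ?_ ?_ ?_ ?_
  · intro σ _
    simp only [Finset.mem_filter, Finset.mem_univ, true_and]
    have : (Set.range fun j => (σ j : ι)) = e \ {i} := by
      rw [show (fun j => (σ j : ι)) = Subtype.val ∘ σ from rfl, σ.surjective.range_comp,
        Subtype.range_coe]
    rw [this, Set.insert_sdiff_singleton, Set.insert_eq_of_mem hi]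
  · intro σ _ τ _ h
    ext j
    exact congrFun h j
  · intro f hf
    simp only [Finset.mem_filter, Finset.mem_univ, true_and] at hf
    have hsub : e \ {i} ⊆ Set.range f := by
      rintro a ⟨ha, hai⟩
      rw [← hf] at ha
      exact ha.resolve_left hai
    have hle : (Set.range f).ncard ≤ r - 1 := by
      rw [← Set.image_univ]
      refine (Set.ncard_image_le).trans ?_
      simp
    have heq : e \ {i} = Set.range f := by
      refine Set.eq_of_subset_of_ncard_le hsub ?_
      rwa [Set.ncard_sdiff_singleton_of_mem hi, he]
    have hmem : ∀ j, f j ∈ e \ {i} := fun j => heq ▸ Set.mem_range_self j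
    have hsurj : Function.Surjective fun j => (⟨f j, hmem j⟩ : ↥(e \ {i})) := by
      rintro ⟨a, ha⟩
      obtain ⟨j, rfl⟩ := hsub ha
      exact ⟨j, rfl⟩
    have hbij : Function.Bijective fun j => (⟨f j, hmem j⟩ : ↥(e \ {i})) := by
      rw [Fintype.bijective_iff_surjective_and_card]
      exact ⟨hsurj, by rw [hcard, Fintype.card_fin]⟩
    exact ⟨Equiv.ofBijective _ hbij, Finset.mem_univ _, rfl⟩
  · intro σ _
    rw [hprod]
    exact (Equiv.prod_comp σ fun j => x j).symm

/-- Grouping the tuples by the edge they span, the $(r-1)!$ orderings cancel the normalisation of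
the tensor. From here on tensors are replaced by link sums. -/
theorem apply_adjacencyTensor {r : ℕ} {G : Hypergraph α} (hfin : G.vertexSet.Finite)
    (hu : G.IsUniform r) (x : α → ℂ) (i : G.vertexSet) :
    (adjacencyTensor r G).apply (fun a => x a) i = linkSum G.edgeSet (fun _ => 1) x i := by
  classical
  have : Finite G.vertexSet := hfin
  have := Fintype.ofFinite G.vertexSet
  set E' : Set (Set G.vertexSet) := {e | Subtype.val '' e ∈ G.edgeSet} with hE'
  have hE : G.edgeSet = Set.image Subtype.val '' E' := by
    ext e
    constructor
    · intro he
      refine ⟨Subtype.val ⁻¹' e, ?_, ?_⟩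
      · simpa [hE', Set.inter_eq_right.2 (subset_vertexSet_of_mem_edgeSet he)] using he
      · simpa using subset_vertexSet_of_mem_edgeSet he
    · rintro ⟨e, he, rfl⟩
      exact he
  rw [hE, linkSum_image Subtype.val_injective, linkSum, RealTensor.apply,
    finsum_eq_sum_of_fintype, finsum_mem_eq_finite_toFinset_sum _ (Set.toFinite _)]
  set T := (Set.toFinite {e ∈ E' | i ∈ e}).toFinset with hT
  have hmem : ∀ f : Fin (r - 1) → G.vertexSet,
      insert (i : α) (Set.range fun j => (f j : α)) ∈ G.edgeSet ↔
        insert i (Set.range f) ∈ T := by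
    intro f
    rw [hT, Set.Finite.mem_toFinset]
    simp only [hE', Set.mem_ofPred_eq, Set.image_insert_eq, ← Set.range_comp, Set.mem_insert_iff,
      true_or, and_true]
    rfl
  have hfac : ((r - 1).factorial : ℂ) ≠ 0 := by exact_mod_cast (r - 1).factorial_ne_zero
  calc ∑ f : Fin (r - 1) → G.vertexSet, ((adjacencyTensor r G i f : ℝ) : ℂ) * ∏ j, x (f j)
      = ∑ f : Fin (r - 1) → G.vertexSet with insert i (Set.range f) ∈ T,
          ((r - 1).factorial : ℂ)⁻¹ * ∏ j, x (f j) := by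
        rw [Finset.sum_filter]
        refine Finset.sum_congr rfl fun f _ => ?_
        simp only [adjacencyTensor, hmem]
        split_ifs <;> simp
    _ = ∑ e ∈ T, ∑ f : Fin (r - 1) → G.vertexSet with insert i (Set.range f) = e,
          ((r - 1).factorial : ℂ)⁻¹ * ∏ j, x (f j) := by
        rw [← Finset.sum_fiberwise_of_maps_to (t := T)
          (g := fun f : Fin (r - 1) → G.vertexSet => insert i (Set.range f))
          (by intro f hf; exact (Finset.mem_filter.1 hf).2)]
        refine Finset.sum_congr rfl fun e he => Finset.sum_congr ?_ fun _ _ => rfl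
        ext f
        simp only [Finset.mem_filter, Finset.mem_univ, true_and]
        exact ⟨fun h => h.2, fun h => ⟨h ▸ he, h⟩⟩
    _ = _ := by
        refine Finset.sum_congr rfl fun e he => ?_
        rw [hT, Set.Finite.mem_toFinset] at he
        have hcard : e.ncard = r := by
          rw [← hu _ he.1, Set.ncard_image_of_injective _ Subtype.val_injective]
        rw [← Finset.mul_sum, sum_prod_ordering hcard he.2 (fun a => x a),
          inv_mul_cancel_left₀ hfac, one_mul]
        rfl

/-- The spectral radius is `l` as soon as `l` has a nonzero real eigenvector and a positive vector
which is mapped below its `l`-multiple. -/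
theorem spectralRadius_eq_of_le_of_eq {r : ℕ} (hr : 2 ≤ r) {G : Hypergraph α}
    (hfin : G.vertexSet.Finite) (hu : G.IsUniform r) {l : ℝ} {x y : α → ℝ}
    (hx : ∀ i ∈ G.vertexSet, 0 < x i)
    (hxl : ∀ i ∈ G.vertexSet, linkSum G.edgeSet (fun _ => 1) x i ≤ l * x i ^ (r - 1))
    (hy : ∃ i ∈ G.vertexSet, y i ≠ 0)
    (hyl : ∀ i ∈ G.vertexSet, linkSum G.edgeSet (fun _ => 1) y i = l * y i ^ (r - 1)) :
    spectralRadius r G = l := by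
  classical
  have hE := edgeSet_finite hfin
  have hEf : ∀ e ∈ G.edgeSet, e.Finite := fun e he =>
    hfin.subset (subset_vertexSet_of_mem_edgeSet he)
  -- The sign is needed because the radius is the modulus of `l`; it follows from the inequality at
  -- any vertex, where the link sum of a positive vector is nonnegative.
  have hl : 0 ≤ l := by
    obtain ⟨i, hi, -⟩ := hy
    have h0 : 0 ≤ linkSum G.edgeSet (fun _ => (1 : ℝ)) x i := by
      refine finsum_mem_induction (0 ≤ ·) le_rfl (fun _ _ => add_nonneg) fun e he => ?_
      rw [one_mul]
      exact finprod_mem_induction (0 ≤ ·) zero_le_one (fun _ _ => mul_nonneg)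
        fun j hj => (hx j (subset_vertexSet_of_mem_edgeSet he.1 hj.1)).le
    exact nonneg_of_mul_nonneg_left (h0.trans (hxl i hi)) (pow_pos (hx i hi) _)
  refine IsGreatest.csSup_eq ⟨⟨l, ⟨fun a => y a, ?_, fun i => ?_⟩, ?_⟩, ?_⟩
  · obtain ⟨i, hi, h⟩ := hy
    intro h0
    have := congrFun h0 ⟨i, hi⟩
    exact h (by simpa using this)
  · rw [apply_adjacencyTensor hfin hu (fun a => (y a : ℂ))]
    have := map_linkSum hE hEf Complex.ofRealHom (fun _ => 1) y i
    simp only [Complex.ofRealHom_eq_coe, Complex.ofReal_one] at this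
    rw [← this, hyl i i.2]
    push_cast
    rfl
  · rw [Complex.norm_real, Real.norm_of_nonneg hl]
  · rintro t ⟨μ, ⟨z, hz, hzμ⟩, rfl⟩
    set Z : α → ℂ := fun a => if h : a ∈ G.vertexSet then z ⟨a, h⟩ else 0 with hZ
    have hzZ : z = fun a : G.vertexSet => Z a := by
      ext a
      simp [hZ]
    have heq : ∀ i ∈ G.vertexSet,
        linkSum G.edgeSet (fun _ => 1) Z i = μ * Z i ^ (r - 1) := by
      intro i hi
      have := hzμ ⟨i, hi⟩
      rw [hzZ] at this
      rw [← this, apply_adjacencyTensor hfin hu]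
    obtain ⟨k, hk⟩ : ∃ k, z k ≠ 0 := Function.ne_iff.1 hz
    -- Collatz-Wielandt comparison: scale `x` until it dominates `‖Z‖`, with equality at `i`, and
    -- compare the two relations at `i`.
    obtain ⟨i, hi, hmax⟩ := Set.exists_max_image G.vertexSet (fun a => ‖Z a‖ / x a) hfin ⟨k, k.2⟩
    set c := ‖Z i‖ / x i with hc
    have hcpos : 0 < c := by
      refine lt_of_lt_of_le ?_ (hmax k k.2)
      have : Z k ≠ 0 := by simpa [hZ] using hk
      exact div_pos (norm_pos_iff.2 this) (hx k k.2)
    have hZc : ∀ a ∈ G.vertexSet, ‖Z a‖ ≤ c * x a := fun a ha =>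
      (div_le_iff₀ (hx a ha)).1 (hmax a ha)
    have hZi : ‖Z i‖ = c * x i := by rw [hc, div_mul_cancel₀ _ (hx i hi).ne']
    have key : ‖μ‖ * (c * x i) ^ (r - 1) ≤ l * (c * x i) ^ (r - 1) := by
      calc ‖μ‖ * (c * x i) ^ (r - 1) = ‖linkSum G.edgeSet (fun _ => 1) Z i‖ := by
            rw [heq i hi, norm_mul, norm_pow, hZi]
        _ ≤ linkSum G.edgeSet (fun _ => 1) (fun j => ‖Z j‖) i := norm_linkSum_le hE hEf _ _
        _ ≤ linkSum G.edgeSet (fun _ => 1) (fun j => c * x j) i :=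
            linkSum_mono hE hEf (fun _ _ => zero_le_one) (fun _ _ _ _ => norm_nonneg _)
              (fun e he j hj => hZc j (subset_vertexSet_of_mem_edgeSet he hj)) i
        _ = c ^ (r - 1) * linkSum G.edgeSet (fun _ => 1) x i :=
            linkSum_smul hE (by omega) hu _ _ _ _
        _ ≤ c ^ (r - 1) * (l * x i ^ (r - 1)) :=
            mul_le_mul_of_nonneg_left (hxl i hi) (by positivity)
        _ = l * (c * x i) ^ (r - 1) := by ring
    exact le_of_mul_le_mul_right key (pow_pos (mul_pos hcpos (hx i hi)) _)

/-! ### Perron-Frobenius by maximising the edge form. -/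

section PerronFrobenius

variable {ι : Type*}

/-- The weighted sum over the edges of the products of the entries of `x`. -/
noncomputable def edgeForm (E : Finset (Finset ι)) (w : Finset ι → ℝ) (x : ι → ℝ) : ℝ :=
  ∑ e ∈ E, w e * ∏ j ∈ e, x j

theorem edgeForm_smul {E : Finset (Finset ι)} {r : ℕ} (hu : ∀ e ∈ E, e.card = r)
    (w : Finset ι → ℝ) (c : ℝ) (x : ι → ℝ) :
    edgeForm E w (fun j => c * x j) = c ^ r * edgeForm E w x := by
  rw [edgeForm, edgeForm, Finset.mul_sum]
  refine Finset.sum_congr rfl fun e he => ?_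
  rw [Finset.prod_mul_distrib, Finset.prod_const, hu e he]
  ring

/-- No edge repeats a vertex, so the form is affine in each coordinate; its slope is the link sum.
-/
theorem edgeForm_update [DecidableEq ι] (E : Finset (Finset ι)) (w : Finset ι → ℝ) (x : ι → ℝ) (i : ι) (s : ℝ) :
    edgeForm E w (Function.update x i s) =
      s * ∑ e ∈ E with i ∈ e, w e * ∏ j ∈ e.erase i, x j +
        ∑ e ∈ E with i ∉ e, w e * ∏ j ∈ e, x j := by
  rw [edgeForm, ← Finset.sum_filter_add_sum_filter_not E (fun e => i ∈ e), Finset.mul_sum]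
  congr 1
  · refine Finset.sum_congr rfl fun e he => ?_
    rw [← Finset.mul_prod_erase _ _ (Finset.mem_filter.1 he).2, Function.update_self,
      Finset.prod_congr rfl fun j hj => Function.update_of_ne (Finset.ne_of_mem_erase hj) _ _]
    ring
  · refine Finset.sum_congr rfl fun e he => ?_
    rw [Finset.prod_congr rfl fun j hj => Function.update_of_ne
      (fun h : j = i => (Finset.mem_filter.1 he).2 (h ▸ hj)) _ _]

/-- Compactness of the nonnegative part of the $\ell^r$ unit sphere gives a maximiser. Homogeneity
of degree `r` then removes the constraint on the competitor, so no Lagrange multipliers are needed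
later. -/
theorem exists_edgeForm_max [Fintype ι] [Nonempty ι] {E : Finset (Finset ι)} {r : ℕ} (hr : 1 ≤ r)
    (hu : ∀ e ∈ E, e.card = r) (w : Finset ι → ℝ) :
    ∃ x : ι → ℝ, (∀ i, 0 ≤ x i) ∧ ∑ i, x i ^ r = 1 ∧
      ∀ y : ι → ℝ, (∀ i, 0 ≤ y i) → edgeForm E w y ≤ edgeForm E w x * ∑ i, y i ^ r := by
  classical
  have hcont : Continuous (edgeForm E w) := by unfold edgeForm; fun_prop
  set S : Set (ι → ℝ) := {x | (∀ i, 0 ≤ x i) ∧ ∑ i, x i ^ r = 1} with hS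
  have hclosed : IsClosed S := by
    rw [hS, Set.ofPred_and, Set.ofPred_forall]
    refine IsClosed.inter (isClosed_iInter fun i => ?_) ?_
    · exact isClosed_le continuous_const (continuous_apply i)
    · exact isClosed_eq (by fun_prop) continuous_const
  have hsub : S ⊆ Set.Icc 0 1 := by
    rintro x ⟨h0, h1⟩
    refine ⟨h0, fun i => ?_⟩
    have : x i ^ r ≤ 1 := by
      rw [← h1]
      exact Finset.single_le_sum (f := fun i => x i ^ r) (fun j _ => pow_nonneg (h0 j) r)
        (Finset.mem_univ i)
    exact (pow_le_one_iff_of_nonneg (h0 i) (by omega)).1 this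
  have hcomp : IsCompact S := isCompact_Icc.of_isClosed_subset hclosed hsub
  have hne : S.Nonempty := by
    obtain ⟨i⟩ := ‹Nonempty ι›
    refine ⟨Pi.single i 1, fun j => ?_, ?_⟩
    · by_cases h : j = i
      · subst h; simp
      · simp [h]
    · rw [Finset.sum_eq_single i]
      · simp
      · intro j _ h
        simp [h, show r ≠ 0 by omega]
      · simp
  obtain ⟨x, ⟨hx0, hx1⟩, hmax⟩ := hcomp.exists_isMaxOn hne hcont.continuousOn
  refine ⟨x, hx0, hx1, fun y hy => ?_⟩
  have hpow : ∀ i, 0 ≤ y i ^ r := fun i => pow_nonneg (hy i) r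
  obtain h | h := (Finset.sum_nonneg fun i (_ : i ∈ Finset.univ) => hpow i).eq_or_lt
  · have hy0 : ∀ i, y i = 0 := fun i =>
      pow_eq_zero_iff (by omega) |>.1
        ((Finset.sum_eq_zero_iff_of_nonneg fun i _ => hpow i).1 h.symm i (Finset.mem_univ i))
    rw [← h, mul_zero]
    refine (Finset.sum_eq_zero fun e he => ?_).le
    obtain ⟨j, hj⟩ : e.Nonempty := by rw [← Finset.card_pos, hu e he]; omega
    rw [Finset.prod_eq_zero hj (hy0 j), mul_zero]
  · set s := ∑ i, y i ^ r with hs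
    set c := s ^ (-(r : ℝ)⁻¹) with hc
    have hcr : c ^ r = s⁻¹ := by
      rw [hc, ← Real.rpow_natCast, ← Real.rpow_mul h.le, neg_mul,
        inv_mul_cancel₀ (by positivity), Real.rpow_neg_one]
    have hmem : (fun j => c * y j) ∈ S := by
      refine ⟨fun i => mul_nonneg (Real.rpow_nonneg h.le _) (hy i), ?_⟩
      simp only [mul_pow, ← Finset.mul_sum, hcr]
      exact inv_mul_cancel₀ h.ne'
    have := hmax hmem
    simp only [Set.mem_ofPred_eq, edgeForm_smul hu, hcr] at this
    rwa [inv_mul_le_iff₀ h, mul_comm] at this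

/-- If the maximiser vanished somewhere, some edge would cross the boundary of its support. Raising
the zeros on that edge to $\varepsilon$ gains order $\varepsilon^{|T|}$ with $|T|<r$, while the norm
grows only by order $\varepsilon^r$: a contradiction for small $\varepsilon$. -/
theorem pos_of_edgeForm_max [Fintype ι] [Nonempty ι] {E : Finset (Finset ι)} {r : ℕ} (hr : 1 ≤ r)
    (hu : ∀ e ∈ E, e.card = r) {w : Finset ι → ℝ} (hw : ∀ e ∈ E, 0 < w e)
    (hcut : ∀ S : Set ι, (∃ a, a ∈ S) → (∃ b, b ∉ S) →
      ∃ e ∈ E, (∃ a ∈ e, a ∈ S) ∧ ∃ b ∈ e, b ∉ S)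
    {x : ι → ℝ} (hx0 : ∀ i, 0 ≤ x i) (hx1 : ∑ i, x i ^ r = 1)
    (hmax : ∀ y : ι → ℝ, (∀ i, 0 ≤ y i) → edgeForm E w y ≤ edgeForm E w x * ∑ i, y i ^ r)
    (i : ι) : 0 < x i := by
  classical
  by_contra hi
  obtain ⟨k, hk⟩ : ∃ k, 0 < x k := by
    by_contra! h
    rw [Finset.sum_eq_zero] at hx1
    · exact zero_ne_one hx1
    · intro j _
      rw [le_antisymm (h j) (hx0 j), zero_pow (by omega)]
  obtain ⟨e, he, ⟨a, hae, ha⟩, b, hbe, hb⟩ := hcut {j | 0 < x j} ⟨k, hk⟩ ⟨i, hi⟩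
  simp only [Set.mem_ofPred_eq] at ha hb
  set T := e.filter fun j => ¬ 0 < x j with hT
  have hxT : ∀ j ∈ T, x j = 0 := fun j hj =>
    le_antisymm (not_lt.1 (Finset.mem_filter.1 hj).2) (hx0 j)
  have hTr : T.card < r := by
    rw [← hu e he]
    refine Finset.card_lt_card ((Finset.filter_subset _ _).ssubset_of_ne fun h => ?_)
    rw [← h] at hae
    exact (Finset.mem_filter.1 hae).2 ha
  set l := edgeForm E w x with hl
  have hl0 : 0 ≤ l := Finset.sum_nonneg fun f hf =>
    mul_nonneg (hw f hf).le (Finset.prod_nonneg fun j _ => hx0 j)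
  set c := w e * ∏ j ∈ e with 0 < x j, x j with hc
  have hc0 : 0 < c := mul_pos (hw e he) (Finset.prod_pos fun j hj => (Finset.mem_filter.1 hj).2)
  have key : ∀ ε : ℝ, 0 < ε → ε ≤ 1 → c ≤ l * T.card * ε := by
    intro ε hε hε1
    set y : ι → ℝ := fun j => if j ∈ T then ε else x j with hy
    have hxy : ∀ j, x j ≤ y j := by
      intro j
      simp only [hy]
      split_ifs with h
      · rw [hxT j h]; exact hε.le
      · exact le_rfl
    have hy0 : ∀ j, 0 ≤ y j := fun j => (hx0 j).trans (hxy j)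
    have h1 : l + c * ε ^ T.card ≤ edgeForm E w y := by
      rw [hl, edgeForm, edgeForm, ← Finset.add_sum_erase E _ he,
        ← Finset.add_sum_erase E (fun f => w f * ∏ j ∈ f, y j) he,
        Finset.prod_eq_zero hbe (le_antisymm (not_lt.1 hb) (hx0 b)), mul_zero, zero_add, add_comm]
      refine add_le_add (le_of_eq ?_) (Finset.sum_le_sum fun f hf => ?_)
      · rw [← Finset.prod_filter_mul_prod_filter_not e (fun j => 0 < x j), hc, mul_assoc]
        congr 2
        · refine Finset.prod_congr rfl fun j hj => ?_
          have : j ∉ T := fun h => (Finset.mem_filter.1 h).2 (Finset.mem_filter.1 hj).2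
          simp [hy, this]
        · rw [← hT, Finset.prod_congr rfl fun j hj => show y j = ε by simp [hy, hj],
            Finset.prod_const]
      · exact mul_le_mul_of_nonneg_left (Finset.prod_le_prod (fun j _ => hx0 j) fun j _ => hxy j)
          (hw f (Finset.mem_of_mem_erase hf)).le
    have h2 : ∑ j, y j ^ r = 1 + T.card * ε ^ r := by
      rw [← hx1, ← nsmul_eq_mul, ← Finset.sum_const, ← Finset.sum_filter_add_sum_filter_not
        Finset.univ (fun j => j ∈ T) (fun j => y j ^ r), ← Finset.sum_filter_add_sum_filter_not
        Finset.univ (fun j => j ∈ T) (fun j => x j ^ r),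
        Finset.sum_eq_zero (s := Finset.univ.filter (· ∈ T)) (f := fun j => x j ^ r), zero_add,
        add_comm]
      · congr 1
        · refine Finset.sum_congr rfl fun j hj => ?_
          simp [hy, (Finset.mem_filter.1 hj).2]
        · refine Finset.sum_congr (by ext; simp) fun j hj => ?_
          simp [hy, hj]
      · intro j hj
        rw [hxT j (Finset.mem_filter.1 hj).2, zero_pow (by omega)]
    have h3 := h1.trans (hmax y hy0)
    rw [h2] at h3
    have h4 : c * ε ^ T.card ≤ l * T.card * ε ^ r := by linarith
    have h5 : ε ^ r ≤ ε * ε ^ T.card := by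
      rw [← pow_succ']
      exact pow_le_pow_of_le_one hε.le hε1 hTr
    have h6 : c * ε ^ T.card ≤ l * T.card * ε * ε ^ T.card := by
      refine h4.trans ?_
      rw [mul_assoc _ ε]
      exact mul_le_mul_of_nonneg_left h5 (by positivity)
    exact le_of_mul_le_mul_right h6 (by positivity)
  set K := l * T.card with hK
  have hK0 : 0 ≤ K := by positivity
  -- Small enough that $K\varepsilon<c$, against `key`; the `+ 1` covers $K=0$.
  set ε := min 1 (c / (2 * (K + 1))) with hε
  have hε0 : 0 < ε := lt_min one_pos (by positivity)
  have h1 := key ε hε0 (min_le_left _ _)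
  have h2 : K * ε ≤ K * (c / (2 * (K + 1))) :=
    mul_le_mul_of_nonneg_left (min_le_right _ _) hK0
  have h3 : K * (c / (2 * (K + 1))) < c := by
    rw [← mul_div_assoc, div_lt_iff₀ (by positivity)]
    nlinarith
  linarith

/-- The Perron-Frobenius theorem for weighted connected uniform hypergraphs on a finite type. -/
theorem exists_pos_eigenvector_finset [Fintype ι] [DecidableEq ι] [Nonempty ι] {E : Finset (Finset ι)} {r : ℕ} (hr : 1 ≤ r)
    (hu : ∀ e ∈ E, e.card = r) {w : Finset ι → ℝ} (hw : ∀ e ∈ E, 0 < w e)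
    (hcut : ∀ S : Set ι, (∃ a, a ∈ S) → (∃ b, b ∉ S) →
      ∃ e ∈ E, (∃ a ∈ e, a ∈ S) ∧ ∃ b ∈ e, b ∉ S) :
    ∃ (l : ℝ) (x : ι → ℝ), (∀ i, 0 < x i) ∧
      ∀ i, ∑ e ∈ E with i ∈ e, w e * ∏ j ∈ e.erase i, x j = l * x i ^ (r - 1) := by
  obtain ⟨x, hx0, hx1, hmax⟩ := exists_edgeForm_max hr hu w
  have hpos := pos_of_edgeForm_max hr hu hw hcut hx0 hx1 hmax
  -- The factor `r` comes from differentiating $s^r$ in the one-variable problem below.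
  refine ⟨edgeForm E w x * r, x, hpos, fun i => ?_⟩
  set l := edgeForm E w x with hl
  set L := ∑ e ∈ E with i ∈ e, w e * ∏ j ∈ e.erase i, x j with hL
  set R := ∑ e ∈ E with i ∉ e, w e * ∏ j ∈ e, x j with hR
  set C := ∑ j ∈ Finset.univ.erase i, x j ^ r with hC
  have hsum : ∀ s : ℝ, ∑ j, Function.update x i s j ^ r = s ^ r + C := by
    intro s
    rw [← Finset.add_sum_erase _ _ (Finset.mem_univ i), Function.update_self, hC]
    congr 1
    exact Finset.sum_congr rfl fun j hj => by
      rw [Function.update_of_ne (Finset.ne_of_mem_erase hj)]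
  -- With only coordinate `i` varying, the homogeneous inequality says that this function is
  -- nonnegative, and it vanishes at `x i`. Positivity of `x i` makes the point interior, so the
  -- derivative is zero there.
  have hmin : IsLocalMin (fun s : ℝ => l * (s ^ r + C) - (s * L + R)) (x i) := by
    filter_upwards [lt_mem_nhds (hpos i)] with s hs
    have h1 := hmax (Function.update x i s) fun j => by
      by_cases h : j = i
      · subst h; simpa using hs.le
      · simpa [h] using hx0 j
    rw [hsum, edgeForm_update] at h1
    have h2 := edgeForm_update E w x i (x i)
    have h3 := hsum (x i)
    rw [Function.update_eq_self] at h2 h3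
    rw [hx1] at h3
    rw [← h3, ← h2]
    linarith
  have hder : HasDerivAt (fun s : ℝ => l * (s ^ r + C) - (s * L + R))
      (l * (r * x i ^ (r - 1)) - 1 * L) (x i) :=
    (((hasDerivAt_pow r (x i)).add_const C).const_mul l).sub
      (((hasDerivAt_id (x i)).mul_const L).add_const R)
  have := hmin.hasDerivAt_eq_zero hder
  linarith

end PerronFrobenius

/-- Every partition of the vertex set into two nonempty parts is crossed by an edge. -/
def IsCutConnected (G : Hypergraph α) : Prop :=
  ∀ S : Set α, (∃ a ∈ G.vertexSet, a ∈ S) → (∃ b ∈ G.vertexSet, b ∉ S) →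
    ∃ e ∈ G.edgeSet, (∃ a ∈ e, a ∈ S) ∧ ∃ b ∈ e, b ∉ S

/-- If no edge crosses `S`, membership in `S` propagates along walks. The positivity argument uses
connectivity only in this form. -/
theorem IsConnected.isCutConnected {G : Hypergraph α} (hG : G.IsConnected) :
    G.IsCutConnected := by
  rintro S ⟨a, haV, ha⟩ ⟨b, hbV, hb⟩
  by_contra! h
  have : ∀ c, Relation.ReflTransGen G.Adj a c → c ∈ S := by
    intro c hc
    induction hc with
    | refl => exact ha
    | tail _ hadj ih =>
      obtain ⟨e, he, h1, h2⟩ := hadj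
      exact h e he ⟨_, h1, ih⟩ _ h2
  exact hb (this b (hG.2 a haV b hbV))

/-- The Perron-Frobenius theorem for weighted connected uniform hypergraphs. -/
theorem exists_pos_eigenvector {r : ℕ} (hr : 1 ≤ r) {G : Hypergraph α}
    (hfin : G.vertexSet.Finite) (hne : G.vertexSet.Nonempty) (hu : G.IsUniform r)
    (hcut : G.IsCutConnected) {w : Set α → ℝ} (hw : ∀ e ∈ G.edgeSet, 0 < w e) :
    ∃ (l : ℝ) (x : α → ℝ), (∀ i ∈ G.vertexSet, 0 < x i) ∧
      ∀ i ∈ G.vertexSet, linkSum G.edgeSet w x i = l * x i ^ (r - 1) := by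
  classical
  have : Finite G.vertexSet := hfin
  have := Fintype.ofFinite G.vertexSet
  have : Nonempty G.vertexSet := hne.to_subtype
  -- The edges are pulled back to the subtype of vertices, where the finite-type version applies;
  -- the eigenvector is then extended by zero.
  set E' : Set (Set G.vertexSet) := {e | Subtype.val '' e ∈ G.edgeSet} with hE'
  have hE : G.edgeSet = Set.image Subtype.val '' E' := by
    ext e
    constructor
    · intro he
      refine ⟨Subtype.val ⁻¹' e, ?_, ?_⟩
      · simpa [hE', Set.inter_eq_right.2 (subset_vertexSet_of_mem_edgeSet he)] using he
      · simpa using subset_vertexSet_of_mem_edgeSet he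
    · rintro ⟨e, he, rfl⟩
      exact he
  set E : Finset (Finset G.vertexSet) := Finset.univ.filter fun e => (e : Set G.vertexSet) ∈ E'
    with hEdef
  have hmemE : ∀ e : Finset G.vertexSet, e ∈ E ↔ Subtype.val '' (e : Set G.vertexSet) ∈ G.edgeSet :=
    fun e => by simp [hEdef, hE']
  obtain ⟨l, x, hx, hl⟩ := exists_pos_eigenvector_finset (E := E) hr
    (fun e he => by
      rw [← hu _ ((hmemE e).1 he), Set.ncard_image_of_injective _ Subtype.val_injective,
        Set.ncard_coe_finset])
    (w := fun e => w (Subtype.val '' (e : Set G.vertexSet)))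
    (fun e he => hw _ ((hmemE e).1 he))
    (by
      rintro S ⟨a, ha⟩ ⟨b, hb⟩
      obtain ⟨e, he, ⟨c, hce, d, hd, rfl⟩, f, hfe, hf⟩ := hcut (Subtype.val '' S)
        ⟨a, a.2, a, ha, rfl⟩ ⟨b, b.2, by simpa using hb⟩
      have hsub := subset_vertexSet_of_mem_edgeSet he
      refine ⟨(Subtype.val ⁻¹' e : Set G.vertexSet).toFinset, ?_, ⟨d, by simpa using hce, hd⟩,
        ⟨f, hsub hfe⟩, by simpa using hfe, fun h => hf ⟨_, h, rfl⟩⟩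
      rw [hmemE]
      simpa [Set.inter_eq_right.2 hsub] using he)
  set X : α → ℝ := fun a => if h : a ∈ G.vertexSet then x ⟨a, h⟩ else 0 with hX
  have hXx : X ∘ Subtype.val = x := by
    ext a
    simp [hX]
  refine ⟨l, X, fun i hi => by simpa [hX, hi] using hx ⟨i, hi⟩, fun i hi => ?_⟩
  have h1 := linkSum_image (Subtype.val_injective (p := (· ∈ G.vertexSet))) E' w X ⟨i, hi⟩
  have h2 : X i = x ⟨i, hi⟩ := by simp [hX, hi]
  rw [hE, h1, hXx, h2, ← hl, linkSum]
  symm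
  rw [← finsum_mem_coe_finset]
  refine finsum_mem_eq_of_bijOn (fun e : Finset G.vertexSet => (e : Set G.vertexSet))
    ⟨?_, Finset.coe_injective.injOn, ?_⟩ ?_
  · intro e he
    simpa [hEdef] using he
  · intro e he
    refine ⟨e.toFinset, ?_, by simp⟩
    simpa [hEdef] using he
  · intro e _
    rw [← Finset.coe_erase, finprod_mem_coe_finset]

/-! ### Link sums in disjoint unions and copies. -/

section LinkSum

variable {R : Type*} [CommSemiring R]

theorem linkSum_congr_edges {E F : Set (Set α)} {i : α} (h : ∀ e, i ∈ e → (e ∈ E ↔ e ∈ F))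
    (w : Set α → R) (x : α → R) : linkSum E w x i = linkSum F w x i := by
  have : {e ∈ E | i ∈ e} = {e ∈ F | i ∈ e} := by
    ext e
    exact ⟨fun ⟨h1, h2⟩ => ⟨(h e h2).1 h1, h2⟩, fun ⟨h1, h2⟩ => ⟨(h e h2).2 h1, h2⟩⟩
  rw [linkSum, this, linkSum]

theorem linkSum_singleton {e : Set α} {i : α} (hi : i ∈ e) (w : Set α → R) (x : α → R) :
    linkSum {e} w x i = w e * ∏ᶠ j ∈ e \ {i}, x j := by
  have : {f ∈ ({e} : Set (Set α)) | i ∈ f} = {e} := by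
    ext f
    simp only [Set.mem_singleton_iff, Set.mem_ofPred_eq]
    exact ⟨fun h => h.1, fun h => ⟨h, h ▸ hi⟩⟩
  rw [linkSum, this, finsum_mem_singleton]

theorem linkSum_disjUnion_inl (G : Hypergraph α) (H : Hypergraph β) (w : Set (α ⊕ β) → R)
    (x : α ⊕ β → R) (a : α) :
    linkSum (G.disjUnion H).edgeSet w x (Sum.inl a) =
      linkSum G.edgeSet (fun e => w (Sum.inl '' e)) (x ∘ Sum.inl) a := by
  rw [← linkSum_image Sum.inl_injective]
  refine linkSum_congr_edges (fun e he => ⟨?_, Or.inl⟩) _ _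
  rintro (h | ⟨f, -, rfl⟩)
  · exact h
  · simp at he

theorem linkSum_disjUnion_inr (G : Hypergraph α) (H : Hypergraph β) (w : Set (α ⊕ β) → R)
    (x : α ⊕ β → R) (b : β) :
    linkSum (G.disjUnion H).edgeSet w x (Sum.inr b) =
      linkSum H.edgeSet (fun e => w (Sum.inr '' e)) (x ∘ Sum.inr) b := by
  rw [← linkSum_image Sum.inr_injective]
  refine linkSum_congr_edges (fun e he => ⟨?_, Or.inr⟩) _ _
  rintro (⟨f, -, rfl⟩ | h)
  · simp at he
  · exact h

theorem linkSum_copies {m : ℕ} (G : Hypergraph α) (w : Set (Fin m × α) → R)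
    (x : Fin m × α → R) (i : Fin m) (a : α) :
    linkSum (G.copies m).edgeSet w x (i, a) =
      linkSum G.edgeSet (fun e => w (Prod.mk i '' e)) (fun a => x (i, a)) a := by
  have hinj : Function.Injective (Prod.mk i : α → Fin m × α) := Prod.mk_right_injective i
  refine Eq.trans ?_ (linkSum_image hinj G.edgeSet w x a)
  refine linkSum_congr_edges (fun e he => ⟨fun h => ?_, fun h => Set.mem_iUnion.2 ⟨i, h⟩⟩) _ _
  obtain ⟨j, f, hf, rfl⟩ := Set.mem_iUnion.1 h
  obtain ⟨b, -, hb⟩ := he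
  obtain rfl : j = i := congrArg Prod.fst hb
  exact ⟨f, hf, rfl⟩

end LinkSum

/-! ### Finiteness, uniformity and the new edges. -/

section Basic

theorem disjUnion_finite {G : Hypergraph α} {H : Hypergraph β} (hG : G.vertexSet.Finite)
    (hH : H.vertexSet.Finite) : (G.disjUnion H).vertexSet.Finite :=
  (hG.image _).union (hH.image _)

theorem copies_finite {G : Hypergraph α} (hG : G.vertexSet.Finite) (m : ℕ) :
    (G.copies m).vertexSet.Finite :=
  Set.finite_iUnion fun _ => hG.image _

theorem IsUniform.disjUnion {G : Hypergraph α} {H : Hypergraph β} {r : ℕ} (hG : G.IsUniform r)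
    (hH : H.IsUniform r) : (G.disjUnion H).IsUniform r := by
  rintro e (⟨f, hf, rfl⟩ | ⟨f, hf, rfl⟩)
  · rw [Set.ncard_image_of_injective _ Sum.inl_injective, hG f hf]
  · rw [Set.ncard_image_of_injective _ Sum.inr_injective, hH f hf]

theorem IsUniform.copies {G : Hypergraph α} {r : ℕ} (hG : G.IsUniform r) (m : ℕ) :
    (G.copies m).IsUniform r := by
  intro e he
  obtain ⟨i, f, hf, rfl⟩ := Set.mem_iUnion.1 he
  rw [Set.ncard_image_of_injective _ (Prod.mk_right_injective i), hG f hf]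

theorem isUniform_trivialOn (S : Set α) (r : ℕ) : (trivialOn S).IsUniform r :=
  fun _ he => he.elim

theorem mem_disjUnion_inl {G : Hypergraph α} {H : Hypergraph β} {a : α} :
    Sum.inl a ∈ (G.disjUnion H).vertexSet ↔ a ∈ G.vertexSet := by
  simp [Hypergraph.disjUnion]

theorem mem_disjUnion_inr {G : Hypergraph α} {H : Hypergraph β} {b : β} :
    Sum.inr b ∈ (G.disjUnion H).vertexSet ↔ b ∈ H.vertexSet := by
  simp [Hypergraph.disjUnion]

theorem mem_copies {G : Hypergraph α} {m : ℕ} {i : Fin m} {a : α} :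
    (i, a) ∈ (G.copies m).vertexSet ↔ a ∈ G.vertexSet := by
  simp [Hypergraph.copies]

/-- The `i`-th new edge of `G_u · mH_v`. -/
def newEdge (r m : ℕ) (u : α) (v : β) (i : Fin m) :
    Set (α ⊕ ((Fin m × β) ⊕ (Fin m × Fin (r - 2)))) :=
  insert (Sum.inl u) (insert (Sum.inr (Sum.inl (i, v)))
    (Set.range fun j : Fin (r - 2) => Sum.inr (Sum.inr (i, j))))

variable {r m : ℕ} {u : α} {v : β} {i : Fin m}

@[simp]
theorem inl_mem_newEdge {a : α} : Sum.inl a ∈ newEdge r m u v i ↔ a = u := by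
  simp [newEdge]

@[simp]
theorem inr_inl_mem_newEdge {p : Fin m × β} :
    Sum.inr (Sum.inl p) ∈ newEdge r m u v i ↔ p = (i, v) := by
  simp [newEdge]

@[simp]
theorem inr_inr_mem_newEdge {p : Fin m × Fin (r - 2)} :
    Sum.inr (Sum.inr p) ∈ newEdge r m u v i ↔ p.1 = i := by
  obtain ⟨a, b⟩ := p
  simp [newEdge, eq_comm]

theorem newEdge_injective (r m : ℕ) (u : α) (v : β) : (newEdge r m u v).Injective := by
  intro i j h
  have : Sum.inr (Sum.inl (i, v)) ∈ newEdge r m u v j := by rw [← h]; simp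
  simpa using this

theorem range_new_injective {r m : ℕ} (i : Fin m) : Function.Injective fun j : Fin (r - 2) =>
    (Sum.inr (Sum.inr (i, j)) : α ⊕ ((Fin m × β) ⊕ (Fin m × Fin (r - 2)))) := by
  intro j k h
  simpa using h

theorem ncard_newEdge (hr : 2 ≤ r) (u : α) (v : β) (i : Fin m) :
    (newEdge r m u v i).ncard = r := by
  have h : (Set.range fun j : Fin (r - 2) =>
      (Sum.inr (Sum.inr (i, j)) : α ⊕ ((Fin m × β) ⊕ (Fin m × Fin (r - 2))))).ncard = r - 2 := by
    rw [← Set.image_univ, Set.ncard_image_of_injective _ (range_new_injective i), Set.ncard_univ,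
      Nat.card_eq_fintype_card, Fintype.card_fin]
  have hf := Set.finite_range fun j : Fin (r - 2) =>
      (Sum.inr (Sum.inr (i, j)) : α ⊕ ((Fin m × β) ⊕ (Fin m × Fin (r - 2))))
  rw [newEdge, Set.ncard_insert_of_notMem (by simp) (hf.insert _),
    Set.ncard_insert_of_notMem (by simp) hf, h]
  omega

variable {R : Type*} [CommSemiring R]

theorem finprod_newEdge_sdiff_inl (x : α ⊕ ((Fin m × β) ⊕ (Fin m × Fin (r - 2))) → R) :
    ∏ᶠ k ∈ newEdge r m u v i \ {Sum.inl u}, x k =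
      x (Sum.inr (Sum.inl (i, v))) * ∏ j, x (Sum.inr (Sum.inr (i, j))) := by
  rw [newEdge, Set.insert_sdiff_self_of_notMem (by simp),
    finprod_mem_insert _ (by simp) (Set.finite_range _),
    finprod_mem_range (range_new_injective i), finprod_eq_prod_of_fintype]

theorem finprod_newEdge_sdiff_inr_inl (x : α ⊕ ((Fin m × β) ⊕ (Fin m × Fin (r - 2))) → R) :
    ∏ᶠ k ∈ newEdge r m u v i \ {Sum.inr (Sum.inl (i, v))}, x k =
      x (Sum.inl u) * ∏ j, x (Sum.inr (Sum.inr (i, j))) := by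
  rw [newEdge, Set.insert_comm, Set.insert_sdiff_self_of_notMem (by simp),
    finprod_mem_insert _ (by simp) (Set.finite_range _),
    finprod_mem_range (range_new_injective i), finprod_eq_prod_of_fintype]

theorem finprod_newEdge_sdiff_inr_inr (x : α ⊕ ((Fin m × β) ⊕ (Fin m × Fin (r - 2))) → R)
    (j : Fin (r - 2)) :
    ∏ᶠ k ∈ newEdge r m u v i \ {Sum.inr (Sum.inr (i, j))}, x k =
      x (Sum.inl u) * (x (Sum.inr (Sum.inl (i, v))) *
        ∏ k ∈ Finset.univ.erase j, x (Sum.inr (Sum.inr (i, k)))) := by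
  have h : newEdge r m u v i \ {Sum.inr (Sum.inr (i, j))} =
      insert (Sum.inl u) (insert (Sum.inr (Sum.inl (i, v)))
        ((fun j : Fin (r - 2) => Sum.inr (Sum.inr (i, j))) '' (Finset.univ.erase j : Finset _))) := by
    ext (a | p | ⟨k, l⟩) <;> simp
    exact ⟨fun ⟨h1, h2⟩ => ⟨fun h => h2 h1 h, h1.symm⟩, fun ⟨h1, h2⟩ => ⟨h2.symm, fun _ => h1⟩⟩
  rw [h, finprod_mem_insert _ (by simp) ((Set.toFinite _).insert _),
    finprod_mem_insert _ (by simp) (Set.toFinite _),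
    finprod_mem_image (range_new_injective i).injOn, finprod_mem_coe_finset]

end Basic

/-! ### Edges, link sums and connectivity of $\mathcal G_u\cdot m\mathcal H_v$. -/

section Attach

variable {r m : ℕ} {G : Hypergraph α} {u : G.vertexSet} {H : Hypergraph β} {v : H.vertexSet}

theorem attach_edgeSet : (G.attach r m u H v).edgeSet =
    (G.disjUnion ((copies m H).disjUnion (trivialOn Set.univ))).edgeSet ∪
      Set.range (newEdge r m u.1 v.1) := rfl

theorem newEdge_mem_attach (i : Fin m) :
    newEdge r m u.1 v.1 i ∈ (G.attach r m u H v).edgeSet := Or.inr ⟨i, rfl⟩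

theorem attach_vertexSet : (G.attach r m u H v).vertexSet =
    (G.disjUnion ((copies m H).disjUnion (trivialOn Set.univ))).vertexSet := rfl

theorem attach_finite (hG : G.vertexSet.Finite) (hH : H.vertexSet.Finite) :
    (G.attach r m u H v).vertexSet.Finite :=
  disjUnion_finite hG (disjUnion_finite (copies_finite hH m) Set.finite_univ)

theorem attach_isUniform (hr : 2 ≤ r) (hG : G.IsUniform r) (hH : H.IsUniform r) :
    (G.attach r m u H v).IsUniform r := by
  rintro e (he | ⟨i, rfl⟩)
  · exact hG.disjUnion ((hH.copies m).disjUnion (isUniform_trivialOn _ r)) e he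
  · exact ncard_newEdge hr u.1 v.1 i

theorem newEdge_notMem (i : Fin m) : newEdge r m u.1 v.1 i ∉
    (G.disjUnion ((copies m H).disjUnion
      (trivialOn (Set.univ : Set (Fin m × Fin (r - 2)))))).edgeSet := by
  rintro (⟨f, -, h⟩ | ⟨f, -, h⟩)
  · have : Sum.inr (Sum.inl (i, v.1)) ∈ newEdge r m u.1 v.1 i := by simp
    rw [← h] at this
    simp at this
  · have : Sum.inl u.1 ∈ newEdge r m u.1 v.1 i := by simp
    rw [← h] at this
    simp at this

variable {R : Type*} [CommSemiring R]

-- All `m` new edges pass through `u`, whereas the base vertex of a copy of `H` lies on just one.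
-- This imbalance is what the scaling by `c` later compensates.
open Classical in
theorem linkSum_attach_inl (hG : G.vertexSet.Finite) (hH : H.vertexSet.Finite)
    (w : Set (α ⊕ ((Fin m × β) ⊕ (Fin m × Fin (r - 2)))) → R)
    (x : α ⊕ ((Fin m × β) ⊕ (Fin m × Fin (r - 2))) → R) (a : α) :
    linkSum (G.attach r m u H v).edgeSet w x (Sum.inl a) =
      linkSum G.edgeSet (fun e => w (Sum.inl '' e)) (x ∘ Sum.inl) a +
        if a = u then ∑ i, w (newEdge r m u.1 v.1 i) *
          (x (Sum.inr (Sum.inl (i, v.1))) * ∏ j, x (Sum.inr (Sum.inr (i, j)))) else 0 := by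
  rw [attach_edgeSet, linkSum_union, linkSum_disjUnion_inl]
  · congr 1
    split_ifs with h
    · subst h
      have : {e ∈ Set.range (newEdge r m u.1 v.1) | Sum.inl u.1 ∈ e} =
          Set.range (newEdge r m u.1 v.1) := by
        ext e
        refine ⟨fun h => h.1, fun h => ⟨h, ?_⟩⟩
        obtain ⟨i, rfl⟩ := h
        simp
      rw [linkSum, this, finsum_mem_range (newEdge_injective _ _ _ _), finsum_eq_sum_of_fintype]
      simp only [finprod_newEdge_sdiff_inl]
    · refine linkSum_eq_zero ?_ _ _
      rintro e ⟨i, rfl⟩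
      simpa using h
  · exact edgeSet_finite
      (disjUnion_finite hG (disjUnion_finite (copies_finite hH m) Set.finite_univ))
  · exact Set.finite_range _
  · rw [Set.disjoint_right]
    rintro e ⟨i, rfl⟩
    exact newEdge_notMem i

open Classical in
theorem linkSum_attach_inr_inl (hG : G.vertexSet.Finite) (hH : H.vertexSet.Finite)
    (w : Set (α ⊕ ((Fin m × β) ⊕ (Fin m × Fin (r - 2)))) → R)
    (x : α ⊕ ((Fin m × β) ⊕ (Fin m × Fin (r - 2))) → R) (i : Fin m) (b : β) :
    linkSum (G.attach r m u H v).edgeSet w x (Sum.inr (Sum.inl (i, b))) =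
      linkSum H.edgeSet (fun e => w (Sum.inr '' (Sum.inl '' (Prod.mk i '' e))))
        (fun b => x (Sum.inr (Sum.inl (i, b)))) b +
        if b = v then w (newEdge r m u.1 v.1 i) *
          (x (Sum.inl u.1) * ∏ j, x (Sum.inr (Sum.inr (i, j)))) else 0 := by
  rw [attach_edgeSet, linkSum_union, linkSum_disjUnion_inr, linkSum_disjUnion_inl, linkSum_copies]
  · congr 1
    split_ifs with h
    · subst h
      rw [linkSum_congr_edges (F := {newEdge r m u.1 v.1 i}), linkSum_singleton (by simp),
        finprod_newEdge_sdiff_inr_inl]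
      rintro e he
      constructor
      · rintro ⟨j, rfl⟩
        obtain rfl : i = j := by simpa using he
        rfl
      · rintro rfl
        exact ⟨i, rfl⟩
    · refine linkSum_eq_zero ?_ _ _
      rintro e ⟨j, rfl⟩
      simp [h]
  · exact edgeSet_finite
      (disjUnion_finite hG (disjUnion_finite (copies_finite hH m) Set.finite_univ))
  · exact Set.finite_range _
  · rw [Set.disjoint_right]
    rintro e ⟨i, rfl⟩
    exact newEdge_notMem i

theorem linkSum_attach_inr_inr
    (w : Set (α ⊕ ((Fin m × β) ⊕ (Fin m × Fin (r - 2)))) → R)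
    (x : α ⊕ ((Fin m × β) ⊕ (Fin m × Fin (r - 2))) → R) (i : Fin m) (j : Fin (r - 2)) :
    linkSum (G.attach r m u H v).edgeSet w x (Sum.inr (Sum.inr (i, j))) =
      w (newEdge r m u.1 v.1 i) * (x (Sum.inl u.1) * (x (Sum.inr (Sum.inl (i, v.1))) *
        ∏ k ∈ Finset.univ.erase j, x (Sum.inr (Sum.inr (i, k))))) := by
  rw [linkSum_congr_edges (F := {newEdge r m u.1 v.1 i}), linkSum_singleton (by simp),
    finprod_newEdge_sdiff_inr_inr]
  rintro e he
  constructor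
  · rintro ((⟨f, -, rfl⟩ | ⟨f, (⟨g, -, rfl⟩ | ⟨g, hg, rfl⟩), rfl⟩) | ⟨k, rfl⟩)
    · simp at he
    · simp at he
    · exact hg.elim
    · obtain rfl : k = i := by simpa [eq_comm] using he
      rfl
  · rintro rfl
    exact newEdge_mem_attach i

theorem attach_isCutConnected (hG : G.IsConnected) (hH : H.IsConnected) :
    (G.attach r m u H v).IsCutConnected := by
  rintro S ⟨a, haV, ha⟩ ⟨b, hbV, hb⟩
  by_contra! h
  have hGS : ∀ T : Set α, (∀ e ∈ G.edgeSet, (∃ a ∈ e, a ∈ T) → ∀ b ∈ e, b ∈ T) →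
      ∀ c ∈ G.vertexSet, ∀ d ∈ G.vertexSet, c ∈ T → d ∈ T := by
    intro T hT c hc d hd hcT
    by_contra hdT
    obtain ⟨e, he, h1, f, hf, hfT⟩ := hG.isCutConnected T ⟨c, hc, hcT⟩ ⟨d, hd, hdT⟩
    exact hfT (hT e he h1 f hf)
  have hHS : ∀ T : Set β, (∀ e ∈ H.edgeSet, (∃ a ∈ e, a ∈ T) → ∀ b ∈ e, b ∈ T) →
      ∀ c ∈ H.vertexSet, ∀ d ∈ H.vertexSet, c ∈ T → d ∈ T := by
    intro T hT c hc d hd hcT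
    by_contra hdT
    obtain ⟨e, he, h1, f, hf, hfT⟩ := hH.isCutConnected T ⟨c, hc, hcT⟩ ⟨d, hd, hdT⟩
    exact hfT (hT e he h1 f hf)
  have h1 := hGS (Sum.inl ⁻¹' S) fun e he ⟨a, hae, haS⟩ b hb =>
    h (Sum.inl '' e) (Or.inl (Or.inl ⟨e, he, rfl⟩)) ⟨_, ⟨a, hae, rfl⟩, haS⟩ _ ⟨b, hb, rfl⟩
  have h2 := fun i : Fin m => hHS ((fun b => Sum.inr (Sum.inl (i, b))) ⁻¹' S)
    fun e he ⟨a, hae, haS⟩ b hb =>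
    h (Sum.inr '' (Sum.inl '' (Prod.mk i '' e)))
      (Or.inl (Or.inr ⟨_, Or.inl ⟨_, Set.mem_iUnion.2 ⟨i, e, he, rfl⟩, rfl⟩, rfl⟩))
      ⟨_, ⟨_, ⟨_, ⟨a, hae, rfl⟩, rfl⟩, rfl⟩, haS⟩ _ ⟨_, ⟨_, ⟨b, hb, rfl⟩, rfl⟩, rfl⟩
  have h3 : ∀ (i : Fin m) (c d), c ∈ newEdge r m u.1 v.1 i → d ∈ newEdge r m u.1 v.1 i →
      c ∈ S → d ∈ S := fun i c d hc hd hcS => h _ (newEdge_mem_attach i) ⟨c, hc, hcS⟩ d hd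
  -- With no crossing edge, each vertex lies on the same side as `u`: inside `G` by connectivity,
  -- from a copy of `H` through its base vertex and new edge.
  have key : ∀ c ∈ (G.attach r m u H v).vertexSet, (c ∈ S ↔ Sum.inl u.1 ∈ S) := by
    intro c hc
    rw [attach_vertexSet] at hc
    rcases c with c | ⟨i, c⟩ | ⟨i, j⟩
    · rw [mem_disjUnion_inl] at hc
      exact ⟨h1 c hc u u.2, h1 u u.2 c hc⟩
    · rw [mem_disjUnion_inr, mem_disjUnion_inl, mem_copies] at hc
      exact ⟨fun hS => h3 i _ _ (by simp) (by simp) (h2 i c hc v v.2 hS),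
        fun hS => h2 i v v.2 c hc (h3 i (Sum.inl u.1) _ (by simp) (by simp) hS)⟩
    · exact ⟨h3 i _ _ (by simp) (by simp), h3 i _ _ (by simp) (by simp)⟩
  exact hb ((key b hbV).2 ((key a haV).1 ha))

end Attach

/-! ### The weighted one-edge join and the spectral radii. -/

/-- A positive eigenvector, for the eigenvalue `l`, of the weighted hypergraph obtained from
`G ∪ H` by adding an edge of weight `w` through `u`, `v` and `r - 2` new vertices. -/
structure IsJoinEigenvector (r : ℕ) (G : Hypergraph α) (u : G.vertexSet) (H : Hypergraph β)
    (v : H.vertexSet) (w l : ℝ) (p : α → ℝ) (q : β → ℝ) (z : Fin (r - 2) → ℝ) : Prop where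
  left_pos : ∀ a ∈ G.vertexSet, 0 < p a
  right_pos : ∀ b ∈ H.vertexSet, 0 < q b
  new_pos : ∀ j, 0 < z j
  left_eq : ∀ a ∈ G.vertexSet, a ≠ u → linkSum G.edgeSet (fun _ => 1) p a = l * p a ^ (r - 1)
  left_base_eq : linkSum G.edgeSet (fun _ => 1) p u + w * (q v * ∏ j, z j) = l * p u ^ (r - 1)
  right_eq : ∀ b ∈ H.vertexSet, b ≠ v → linkSum H.edgeSet (fun _ => 1) q b = l * q b ^ (r - 1)
  right_base_eq : linkSum H.edgeSet (fun _ => 1) q v + w * (p u * ∏ j, z j) = l * q v ^ (r - 1)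
  new_eq : ∀ j, w * (p u * (q v * ∏ k ∈ Finset.univ.erase j, z k)) = l * z j ^ (r - 1)

namespace IsJoinEigenvector

variable {r : ℕ} {G : Hypergraph α} {u : G.vertexSet} {H : Hypergraph β} {v : H.vertexSet}
  {w l : ℝ} {p : α → ℝ} {q : β → ℝ} {z : Fin (r - 2) → ℝ}

/-- The source of the spectral symmetry: one edge joins the two sides, so they play equal roles and
share `w` and `l`. -/
theorem symm (h : IsJoinEigenvector r G u H v w l p q z) :
    IsJoinEigenvector r H v G u w l q p z where
  left_pos := h.right_pos
  right_pos := h.left_pos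
  new_pos := h.new_pos
  left_eq := h.right_eq
  left_base_eq := h.right_base_eq
  right_eq := h.left_eq
  right_base_eq := h.left_base_eq
  new_eq j := by rw [← h.new_eq j]; ring

/-- Forgetting the joining edge drops a nonnegative term at `u` and changes nothing elsewhere. This
lets `p` serve as a comparison vector on the spare copies of `G`. -/
theorem linkSum_left_le (h : IsJoinEigenvector r G u H v w l p q z) (hw : 0 ≤ w) {a : α}
    (ha : a ∈ G.vertexSet) : linkSum G.edgeSet (fun _ => 1) p a ≤ l * p a ^ (r - 1) := by
  by_cases hau : a = u
  · subst hau
    rw [← h.left_base_eq]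
    have h1 := (h.right_pos v v.2).le
    have h2 : 0 ≤ ∏ j, z j := Finset.prod_nonneg fun j _ => (h.new_pos j).le
    have : 0 ≤ w * (q v * ∏ j, z j) := by positivity
    linarith
  · exact (h.left_eq a ha hau).le

end IsJoinEigenvector

/-- The join is the case $m=1$ of the construction, with weight `w` on its only new edge and 1 on
the others; Perron-Frobenius applies to it. -/
theorem exists_isJoinEigenvector {r : ℕ} (hr : 2 ≤ r) {G : Hypergraph α} {H : Hypergraph β}
    (hGf : G.vertexSet.Finite) (hGu : G.IsUniform r) (hGc : G.IsConnected)
    (hHf : H.vertexSet.Finite) (hHu : H.IsUniform r) (hHc : H.IsConnected)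
    (u : G.vertexSet) (v : H.vertexSet) {w : ℝ} (hw : 0 < w) :
    ∃ l p q z, IsJoinEigenvector r G u H v w l p q z := by
  classical
  set W : Set (α ⊕ ((Fin 1 × β) ⊕ (Fin 1 × Fin (r - 2)))) → ℝ :=
    fun e => if e = newEdge r 1 u.1 v.1 0 then w else 1 with hW
  have hW0 : W (newEdge r 1 u.1 v.1 0) = w := if_pos rfl
  have hWG : ∀ e, W (Sum.inl '' e) = 1 := by
    intro e
    refine if_neg fun h => ?_
    have : Sum.inr (Sum.inl (0, v.1)) ∈ newEdge r 1 u.1 v.1 0 := by simp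
    rw [← h] at this
    simp at this
  have hWH : ∀ e, W (Sum.inr '' e) = 1 := by
    intro e
    refine if_neg fun h => ?_
    have : Sum.inl u.1 ∈ newEdge r 1 u.1 v.1 0 := by simp
    rw [← h] at this
    simp at this
  obtain ⟨l, x, hx, hl⟩ := exists_pos_eigenvector (r := r) (by omega)
    (attach_finite (r := r) (m := 1) (u := u) (v := v) hGf hHf)
    ⟨Sum.inl u.1, mem_disjUnion_inl.2 u.2⟩ (attach_isUniform hr hGu hHu)
    (attach_isCutConnected hGc hHc) (w := W)
    (fun e _ => by simp only [hW]; split_ifs <;> [exact hw; exact one_pos])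
  have hGm : ∀ {a}, a ∈ G.vertexSet → Sum.inl a ∈ (G.attach r 1 u H v).vertexSet :=
    fun ha => mem_disjUnion_inl.2 ha
  have hHm : ∀ {b}, b ∈ H.vertexSet →
      Sum.inr (Sum.inl (0, b)) ∈ (G.attach r 1 u H v).vertexSet :=
    fun hb => mem_disjUnion_inr.2 (mem_disjUnion_inl.2 (mem_copies.2 hb))
  have hNm : ∀ j, Sum.inr (Sum.inr (0, j)) ∈ (G.attach r 1 u H v).vertexSet :=
    fun j => mem_disjUnion_inr.2 (mem_disjUnion_inr.2 (Set.mem_univ _))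
  refine ⟨l, fun a => x (Sum.inl a), fun b => x (Sum.inr (Sum.inl (0, b))),
    fun j => x (Sum.inr (Sum.inr (0, j))), fun a ha => hx _ (hGm ha), fun b hb => hx _ (hHm hb),
    fun j => hx _ (hNm j), fun a ha hau => ?_, ?_, fun b hb hbv => ?_, ?_, fun j => ?_⟩
  · rw [← hl _ (hGm ha), linkSum_attach_inl hGf hHf, if_neg hau, add_zero]
    simp only [hWG]
    rfl
  · rw [← hl _ (hGm u.2), linkSum_attach_inl hGf hHf, if_pos rfl]
    simp only [hWG, Fin.sum_univ_one, hW0]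
    rfl
  · rw [← hl _ (hHm hb), linkSum_attach_inr_inl hGf hHf, if_neg hbv, add_zero]
    simp only [hWH]
  · rw [← hl _ (hHm v.2), linkSum_attach_inr_inl hGf hHf, if_pos rfl]
    simp only [hWH, hW0]
  · rw [← hl _ (hNm j), linkSum_attach_inr_inr, hW0]

namespace IsJoinEigenvector

variable {r m : ℕ} {G : Hypergraph α} {u : G.vertexSet} {H : Hypergraph β} {v : H.vertexSet}
  {c l : ℝ} {p : α → ℝ} {q : β → ℝ} {z : Fin (r - 2) → ℝ}

/-- The eigenvector of `G_u · mH_v` that restricts to `p` on `G`, and to multiples of `q` and `z`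
on the copies of `H` and on the new vertices. -/
theorem linkSum_attach_eq (h : IsJoinEigenvector r G u H v c⁻¹ l p q z) (hr : 3 ≤ r)
    (hGf : G.vertexSet.Finite) (hHf : H.vertexSet.Finite) (hHu : H.IsUniform r)
    (hc : 0 < c) (hcm : m * c ^ r = 1) :
    ∀ k ∈ (G.attach r m u H v).vertexSet,
      0 < (Sum.elim p (Sum.elim (fun t : Fin m × β => c * q t.2)
        (fun t : Fin m × Fin (r - 2) => c * z t.2)) : _ → ℝ) k ∧
      linkSum (G.attach r m u H v).edgeSet (fun _ => 1)
        (Sum.elim p (Sum.elim (fun t => c * q t.2) (fun t => c * z t.2))) k =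
        l * (Sum.elim p (Sum.elim (fun t : Fin m × β => c * q t.2)
          (fun t : Fin m × Fin (r - 2) => c * z t.2)) : _ → ℝ) k ^ (r - 1) := by
  -- The exponents $r-1$, $r-2$, $r-3$ of `c` become `s + 2`, `s + 1`, `s`, free of truncated
  -- subtraction.
  obtain ⟨s, rfl⟩ : ∃ s, r = s + 3 := ⟨r - 3, by omega⟩
  have hprod : ∏ j, c * z j = c ^ (s + 1) * ∏ j, z j := by
    rw [Finset.prod_mul_distrib, Finset.prod_const, Finset.card_univ, Fintype.card_fin]
    rfl
  have hprod' : ∀ j, ∏ k ∈ Finset.univ.erase j, c * z k =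
      c ^ s * ∏ k ∈ Finset.univ.erase j, z k := by
    intro j
    rw [Finset.prod_mul_distrib, Finset.prod_const, Finset.card_erase_of_mem (Finset.mem_univ j),
      Finset.card_univ, Fintype.card_fin]
    rfl
  have hcopy : ∀ b, linkSum H.edgeSet (fun _ => 1) (fun b => c * q b) b =
      c ^ (s + 2) * linkSum H.edgeSet (fun _ => 1) q b := fun b =>
    linkSum_smul (edgeSet_finite hHf) (by omega) hHu _ c q b
  have hs : s + 3 - 1 = s + 2 := rfl
  rintro (a | ⟨i, b⟩ | ⟨i, j⟩) hk <;> rw [attach_vertexSet] at hk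
  · rw [mem_disjUnion_inl] at hk
    refine ⟨h.left_pos a hk, ?_⟩
    rw [linkSum_attach_inl hGf hHf]
    split_ifs with hau
    · subst hau
      have h1 := h.left_base_eq
      simp only [Sum.elim_inl, Sum.elim_inr, Sum.elim_comp_inl, hprod, one_mul, Finset.sum_const,
        Finset.card_univ, Fintype.card_fin, nsmul_eq_mul]
      rw [← h1]
      congr 1
      -- The equation that dictates the choice of `c`: `m` unit edges at `u`, each scaled by
      -- $c^{r-1}$, replace one edge of weight $c^{-1}$.
      have : c⁻¹ = m * (c * c ^ (s + 1)) := by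
        refine inv_eq_of_mul_eq_one_left ?_
        rw [← hcm]
        ring
      rw [this]
      ring
    · rw [add_zero]
      exact h.left_eq a hk hau
  · rw [mem_disjUnion_inr, mem_disjUnion_inl, mem_copies] at hk
    refine ⟨mul_pos hc (h.right_pos b hk), ?_⟩
    rw [linkSum_attach_inr_inl hGf hHf]
    simp only [Sum.elim_inl, Sum.elim_inr, hcopy, hprod, one_mul]
    split_ifs with hbv
    · subst hbv
      rw [mul_pow, mul_left_comm l, ← h.right_base_eq, hs]
      field_simp
      ring
    · rw [add_zero, h.right_eq b hk hbv, hs]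
      ring
  · refine ⟨mul_pos hc (h.new_pos j), ?_⟩
    rw [linkSum_attach_inr_inr]
    simp only [Sum.elim_inl, Sum.elim_inr, hprod', one_mul]
    rw [mul_pow, mul_left_comm l, ← h.new_eq j, hs]
    field_simp
    ring

theorem spectralRadius_attach (h : IsJoinEigenvector r G u H v c⁻¹ l p q z) (hr : 3 ≤ r)
    (hGf : G.vertexSet.Finite) (hGu : G.IsUniform r) (hHf : H.vertexSet.Finite)
    (hHu : H.IsUniform r) (hc : 0 < c) (hcm : m * c ^ r = 1) :
    spectralRadius r (G.attach r m u H v) = l := by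
  have key := h.linkSum_attach_eq hr hGf hHf hHu hc hcm
  exact spectralRadius_eq_of_le_of_eq (by omega) (attach_finite hGf hHf)
    (attach_isUniform (by omega) hGu hHu) (fun i hi => (key i hi).1) (fun i hi => (key i hi).2.le)
    ⟨Sum.inl u.1, mem_disjUnion_inl.2 u.2, ((key _ (mem_disjUnion_inl.2 u.2)).1).ne'⟩
    (fun i hi => (key i hi).2)

/-- Two different vectors are used. Continued by `p` on the spare copies, the eigenvector stays
positive and gives the upper bound; continued by zero, it is an exact eigenvector and shows that `l`
is attained. -/
theorem spectralRadius_attach_disjUnion (h : IsJoinEigenvector r G u H v c⁻¹ l p q z) (hr : 3 ≤ r)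
    (hGf : G.vertexSet.Finite) (hGu : G.IsUniform r) (hHf : H.vertexSet.Finite)
    (hHu : H.IsUniform r) (hc : 0 < c) (hcm : m * c ^ r = 1) (n : ℕ) :
    spectralRadius r ((G.attach r m u H v).disjUnion (G.copies n)) = l := by
  have key := h.linkSum_attach_eq hr hGf hHf hHu hc hcm
  set x : α ⊕ ((Fin m × β) ⊕ (Fin m × Fin (r - 2))) → ℝ :=
    Sum.elim p (Sum.elim (fun t => c * q t.2) (fun t => c * z t.2)) with hx
  refine spectralRadius_eq_of_le_of_eq (by omega)
    (disjUnion_finite (attach_finite hGf hHf) (copies_finite hGf n))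
    ((attach_isUniform (by omega) hGu hHu).disjUnion (hGu.copies n))
    -- Zero is written as `0 * p` so that `linkSum_smul` evaluates its link sum.
    (x := Sum.elim x fun t => p t.2) (y := Sum.elim x fun t => 0 * p t.2) ?_ ?_
    ⟨Sum.inl (Sum.inl u.1), mem_disjUnion_inl.2 (mem_disjUnion_inl.2 u.2),
      (key _ (mem_disjUnion_inl.2 u.2)).1.ne'⟩ ?_
  · rintro (k | ⟨i, a⟩) hk
    · exact (key k (mem_disjUnion_inl.1 hk)).1
    · exact h.left_pos a (mem_copies.1 (mem_disjUnion_inr.1 hk))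
  · rintro (k | ⟨i, a⟩) hk
    · rw [linkSum_disjUnion_inl]
      exact (key k (mem_disjUnion_inl.1 hk)).2.le
    · rw [linkSum_disjUnion_inr, linkSum_copies]
      exact h.linkSum_left_le (inv_pos.2 hc).le (mem_copies.1 (mem_disjUnion_inr.1 hk))
  · rintro (k | ⟨i, a⟩) hk
    · rw [linkSum_disjUnion_inl]
      exact (key k (mem_disjUnion_inl.1 hk)).2
    · rw [linkSum_disjUnion_inr, linkSum_copies]
      refine (linkSum_smul (edgeSet_finite hGf) (by omega) hGu _ 0 p a).trans ?_
      simp [show r - 1 ≠ 0 by omega]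

end IsJoinEigenvector

/-! ### Generating functions of matchings. -/

section MatchSum

/-- The sets of pairwise disjoint members of `E`. -/
def matchings (E : Set (Set α)) : Set (Finset (Set α)) :=
  {M | (M : Set (Set α)) ⊆ E ∧ (M : Set (Set α)).PairwiseDisjoint id}

theorem matchings_finite {E : Set (Set α)} (hE : E.Finite) : (matchings E).Finite := by
  refine (hE.finite_subsets.preimage Finset.coe_injective.injOn).subset fun M hM => ?_
  exact hM.1

/-- The generating function `∑ t ^ |M|` of the sets `M` of pairwise disjoint members of `E`. -/
noncomputable def matchSum (E : Set (Set α)) (t : ℂ) : ℂ :=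
  ∑ᶠ M ∈ matchings E, t ^ M.card

@[simp]
theorem matchSum_empty (t : ℂ) : matchSum (∅ : Set (Set α)) t = 1 := by
  have : matchings (∅ : Set (Set α)) = {∅} := by
    ext M
    simp only [matchings, Set.subset_empty_iff, Finset.coe_eq_empty, Set.mem_ofPred_eq,
      Set.mem_singleton_iff]
    exact ⟨fun h => h.1, fun h => ⟨h, by simp [h]⟩⟩
  rw [matchSum, this, finsum_mem_singleton, Finset.card_empty, pow_zero]

theorem matchSum_image {f : α → β} (hf : f.Injective) (E : Set (Set α)) (t : ℂ) :
    matchSum (Set.image f '' E) t = matchSum E t := by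
  symm
  refine finsum_mem_eq_of_bijOn (Finset.map ⟨Set.image f, hf.image_injective⟩)
    ⟨?_, (Finset.map_injective _).injOn, ?_⟩ fun M _ => by rw [Finset.card_map]
  · rintro M ⟨h1, h2⟩
    refine ⟨by simpa using Set.image_mono h1, ?_⟩
    rw [Finset.coe_map]
    rintro _ ⟨e, he, rfl⟩ _ ⟨f', hf', rfl⟩ hne
    exact Set.disjoint_image_of_injective hf (h2 he hf' fun h => hne (h ▸ rfl))
  · rintro M ⟨h1, h2⟩
    obtain ⟨N, hN, rfl⟩ := Finset.subset_set_image_iff.1 h1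
    refine ⟨N, ⟨hN, ?_⟩, by ext; simp⟩
    intro e he f' hf' hne
    exact (Set.disjoint_image_iff hf).1
      (h2 (by simpa using ⟨e, he, rfl⟩) (by simpa using ⟨f', hf', rfl⟩)
        fun h => hne (hf.image_injective h))

/-- A matching splits uniquely into its parts in `E` and in `F`. Nonempty members are required: an
empty edge is disjoint from itself and could belong to both families. -/
theorem matchSum_union {E F : Set (Set α)} (hE : E.Finite) (hF : F.Finite)
    (hne : ∀ e ∈ E, e.Nonempty) (hEF : ∀ e ∈ E, ∀ f ∈ F, Disjoint e f) (t : ℂ) :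
    matchSum (E ∪ F) t = matchSum E t * matchSum F t := by
  classical
  have hdisj : ∀ e ∈ E, e ∉ F := fun e he hf => by
    obtain ⟨a, ha⟩ := hne e he
    exact Set.disjoint_left.1 (hEF e he e hf) ha ha
  rw [matchSum, matchSum, matchSum,
    finsum_mem_eq_finite_toFinset_sum _ (matchings_finite hE),
    finsum_mem_eq_finite_toFinset_sum _ (matchings_finite hF),
    finsum_mem_eq_finite_toFinset_sum _ (matchings_finite (hE.union hF)), Finset.sum_mul_sum,
    ← Finset.sum_product']
  symm
  refine Finset.sum_bij' (fun P _ => P.1 ∪ P.2)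
    (fun M _ => (M.filter (· ∈ E), M.filter (· ∈ F))) ?_ ?_ ?_ ?_ ?_
  · rintro ⟨M, N⟩ h
    simp only [Finset.mem_product, Set.Finite.mem_toFinset] at h ⊢
    obtain ⟨⟨h1, h2⟩, h3, h4⟩ := h
    refine ⟨by simpa using Set.union_subset_union h1 h3, ?_⟩
    rw [Finset.coe_union]
    rintro e (he | he) f (hf | hf) hef
    · exact h2 he hf hef
    · exact hEF e (h1 he) f (h3 hf)
    · exact (hEF f (h1 hf) e (h3 he)).symm
    · exact h4 he hf hef
  · intro M h
    simp only [Finset.mem_product, Set.Finite.mem_toFinset] at h ⊢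
    refine ⟨⟨fun e he => (Finset.mem_filter.1 he).2, h.2.subset ?_⟩,
      fun e he => (Finset.mem_filter.1 he).2, h.2.subset ?_⟩ <;>
    exact Finset.coe_subset.2 (Finset.filter_subset _ _)
  · rintro ⟨M, N⟩ h
    simp only [Finset.mem_product, Set.Finite.mem_toFinset] at h
    have h1 : ∀ e ∈ M, e ∈ E := h.1.1
    have h2 : ∀ e ∈ N, e ∈ F := h.2.1
    ext e <;> simp only [Finset.mem_filter, Finset.mem_union]
    · exact ⟨fun ⟨h3, h4⟩ => h3.resolve_right fun h5 => hdisj e h4 (h2 e h5),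
        fun h3 => ⟨Or.inl h3, h1 e h3⟩⟩
    · exact ⟨fun ⟨h3, h4⟩ => h3.resolve_left fun h5 => hdisj e (h1 e h5) h4,
        fun h3 => ⟨Or.inr h3, h2 e h3⟩⟩
  · intro M h
    rw [Set.Finite.mem_toFinset] at h
    ext e
    simp only [Finset.mem_filter, Finset.mem_union]
    exact ⟨fun h1 => h1.elim And.left And.left, fun h1 => (h.1 h1).imp (⟨h1, ·⟩) (⟨h1, ·⟩)⟩
  · rintro ⟨M, N⟩ h
    simp only [Finset.mem_product, Set.Finite.mem_toFinset] at h
    rw [Finset.card_union_of_disjoint, pow_add]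
    exact Finset.disjoint_left.2 fun e he hf => hdisj e (h.1.1 he) (h.2.1 hf)

theorem matchSum_biUnion {κ : Type*} {E : κ → Set (Set α)} (hE : ∀ i, (E i).Finite)
    (hne : ∀ i, ∀ e ∈ E i, e.Nonempty)
    (hdisj : ∀ i j, i ≠ j → ∀ e ∈ E i, ∀ f ∈ E j, Disjoint e f) (s : Finset κ) (t : ℂ) :
    matchSum (⋃ i ∈ s, E i) t = ∏ i ∈ s, matchSum (E i) t := by
  classical
  induction s using Finset.induction_on with
  | empty => simp
  | insert a s ha ih =>
    rw [Finset.set_biUnion_insert, Finset.prod_insert ha, ← ih]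
    refine matchSum_union (hE a) (s.finite_toSet.biUnion fun i _ => hE i) (hne a) ?_ t
    intro e he f hf
    obtain ⟨i, hi, hfi⟩ := Set.mem_iUnion₂.1 hf
    exact hdisj a i (fun h => ha (h ▸ hi)) e he f hfi

/-- Deletion recursion: a matching either avoids `e`, or is `e` together with a matching of the
edges that miss it. -/
theorem matchSum_insert {E : Set (Set α)} (hE : E.Finite) {e : Set α} (he : e ∉ E) (t : ℂ) :
    matchSum (insert e E) t = matchSum E t + t * matchSum {f ∈ E | Disjoint f e} t := by
  classical
  have hfin : {f ∈ E | Disjoint f e}.Finite := hE.subset fun _ h => h.1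
  have hmem : ∀ M ∈ matchings {f ∈ E | Disjoint f e}, e ∉ M := fun M hM h => he (hM.1 h).1
  have h1 : matchings (insert e E) =
      matchings E ∪ insert e '' matchings {f ∈ E | Disjoint f e} := by
    ext M
    constructor
    · rintro ⟨hM, hd⟩
      by_cases heM : e ∈ M
      · refine Or.inr ⟨M.erase e, ⟨fun f hf => ?_, hd.subset ?_⟩, Finset.insert_erase heM⟩
        · have hf' := Finset.mem_erase.1 (Finset.mem_coe.1 hf)
          exact ⟨(hM hf'.2).resolve_left hf'.1, hd hf'.2 heM hf'.1⟩
        · exact Finset.coe_subset.2 (Finset.erase_subset _ _)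
      · exact Or.inl ⟨fun f hf => (hM hf).resolve_left fun h => heM (h ▸ hf), hd⟩
    · rintro (⟨hM, hd⟩ | ⟨N, ⟨hN, hd⟩, rfl⟩)
      · exact ⟨hM.trans (Set.subset_insert _ _), hd⟩
      · rw [matchings, Set.mem_ofPred_eq, Finset.coe_insert]
        refine ⟨Set.insert_subset_insert fun f hf => (hN hf).1, ?_⟩
        exact hd.insert fun f hf _ => (hN hf).2.symm
  have hinj : Set.InjOn (insert e) (matchings {f ∈ E | Disjoint f e}) := by
    intro M hM N hN h
    rw [← Finset.erase_insert (hmem M hM), h, Finset.erase_insert (hmem N hN)]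
  rw [matchSum, h1, finsum_mem_union _ (matchings_finite hE) ((matchings_finite hfin).image _),
    finsum_mem_image hinj, matchSum, matchSum, mul_finsum_mem]
  · congr 1
    refine finsum_mem_congr rfl fun M hM => ?_
    rw [Finset.card_insert_of_notMem (hmem M hM), pow_succ']
  · rw [Set.disjoint_right]
    rintro _ ⟨N, -, rfl⟩ h
    exact he (h.1 (by simp))

/-- A matching contains at most one of the mutually meeting edges `e i`, so the recursion produces a
sum with no cross terms. -/
theorem matchSum_union_of_pairwise_not_disjoint {κ : Type*} {E : Set (Set α)} (hE : E.Finite)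
    {e : κ → Set α} (he : ∀ i, e i ∉ E) (hinj : e.Injective)
    (hmeet : ∀ i j, ¬ Disjoint (e i) (e j)) (s : Finset κ) (t : ℂ) :
    matchSum (E ∪ e '' s) t =
      matchSum E t + ∑ i ∈ s, t * matchSum {f ∈ E | Disjoint f (e i)} t := by
  classical
  induction s using Finset.induction_on with
  | empty => simp
  | insert a s ha ih =>
    have h1 : E ∪ e '' (insert a s : Finset κ) = insert (e a) (E ∪ e '' s) := by
      rw [Finset.coe_insert, Set.image_insert_eq, Set.union_insert]
    have h2 : {f ∈ E ∪ e '' s | Disjoint f (e a)} = {f ∈ E | Disjoint f (e a)} := by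
      ext f
      refine ⟨?_, fun h => ⟨Or.inl h.1, h.2⟩⟩
      rintro ⟨h | ⟨i, -, rfl⟩, h'⟩
      · exact ⟨h, h'⟩
      · exact (hmeet i a h').elim
    rw [h1, matchSum_insert (hE.union (s.finite_toSet.image e)), ih, h2, Finset.sum_insert ha]
    · ring
    · rintro (h | ⟨i, hi, h⟩)
      · exact he a h
      · exact ha (hinj h ▸ hi)

end MatchSum

/-! ### Matching polynomials and the symmetry of the matching energy. -/

theorem IsUniform.edge_nonempty {G : Hypergraph α} {r : ℕ} (hG : G.IsUniform r) (hr : 1 ≤ r)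
    {e : Set α} (he : e ∈ G.edgeSet) : e.Nonempty :=
  Set.nonempty_of_ncard_ne_zero (by rw [hG e he]; omega)

theorem card_mul_le_of_mem_matchings {G : Hypergraph α} {r : ℕ} (hfin : G.vertexSet.Finite)
    (hG : G.IsUniform r) {M : Finset (Set α)} (hM : M ∈ matchings G.edgeSet) :
    M.card * r ≤ G.vertexSet.ncard := by
  have h1 : (⋃ e ∈ (M : Set (Set α)), e).ncard = ∑ᶠ e ∈ (M : Set (Set α)), e.ncard :=
    M.finite_toSet.ncard_biUnion
      (fun e he => hfin.subset (subset_vertexSet_of_mem_edgeSet (hM.1 he))) hM.2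
  rw [finsum_mem_coe_finset, Finset.sum_congr rfl fun e he => hG e (hM.1 he), Finset.sum_const,
    smul_eq_mul] at h1
  rw [← h1]
  exact Set.ncard_le_ncard
    (Set.iUnion₂_subset fun e he => subset_vertexSet_of_mem_edgeSet (hM.1 he)) hfin

/-- For $x\ne0$ one has $(-1)^kx^{n-kr}=x^n(-x^{-r})^k$. No matching is lost to the finite range of
`k`, since `k` disjoint edges occupy $kr\le n$ vertices. -/
theorem eval_matchingPolynomial {G : Hypergraph α} {r : ℕ} (hr : 1 ≤ r)
    (hfin : G.vertexSet.Finite) (hG : G.IsUniform r) {x : ℂ} (hx : x ≠ 0) :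
    (matchingPolynomial r G).eval x =
      x ^ G.vertexSet.ncard * matchSum G.edgeSet (-(x ^ r)⁻¹) := by
  classical
  have hM := matchings_finite (edgeSet_finite hfin)
  have hle := fun M (h : M ∈ matchings G.edgeSet) => card_mul_le_of_mem_matchings hfin hG h
  have hnum : ∀ k, G.numMatchings k = (hM.toFinset.filter fun M => M.card = k).card := by
    intro k
    rw [numMatchings, ← Set.ncard_coe_finset]
    congr 1
    ext M
    simp [matchings]
    tauto
  rw [matchSum, finsum_mem_eq_finite_toFinset_sum _ hM, matchingPolynomial,
    Polynomial.eval_finsetSum, ← Finset.sum_fiberwise_of_maps_to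
      (t := Finset.range (G.vertexSet.ncard / r + 1)) (g := Finset.card), Finset.mul_sum]
  · refine Finset.sum_congr rfl fun k hk => ?_
    have hkr : k * r ≤ G.vertexSet.ncard :=
      (Nat.le_div_iff_mul_le (by omega)).1 (Nat.lt_succ_iff.1 (Finset.mem_range.1 hk))
    rw [Finset.sum_congr rfl fun M h => by rw [(Finset.mem_filter.1 h).2], Finset.sum_const,
      hnum]
    simp only [Polynomial.eval_mul, Polynomial.eval_C, Polynomial.eval_pow, Polynomial.eval_X,
      nsmul_eq_mul]
    rw [pow_sub₀ x hx hkr, neg_pow (x ^ r)⁻¹, inv_pow, ← pow_mul, mul_comm r k]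
    ring
  · intro M h
    rw [Finset.mem_range, Nat.lt_succ_iff, Nat.le_div_iff_mul_le (by omega)]
    exact hle M (hM.mem_toFinset.1 h)

/-- The polynomials agree at every nonzero complex number, hence at infinitely many points. -/
theorem matchingPolynomial_eq {G : Hypergraph α} {H : Hypergraph β} {r : ℕ} (hr : 1 ≤ r)
    (hGf : G.vertexSet.Finite) (hG : G.IsUniform r) (hHf : H.vertexSet.Finite)
    (hH : H.IsUniform r) (hn : G.vertexSet.ncard = H.vertexSet.ncard)
    (h : ∀ t, matchSum G.edgeSet t = matchSum H.edgeSet t) :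
    matchingPolynomial r G = matchingPolynomial r H := by
  refine Polynomial.eq_of_infinite_eval_eq _ _ (Set.Infinite.mono ?_
    (Set.finite_singleton (0 : ℂ)).infinite_compl)
  intro x hx
  rw [Set.mem_ofPred_eq, eval_matchingPolynomial hr hGf hG hx, eval_matchingPolynomial hr hHf hH hx,
    hn, h]

theorem matchSum_disjUnion {G : Hypergraph α} {H : Hypergraph β} {r : ℕ} (hr : 1 ≤ r)
    (hGf : G.vertexSet.Finite) (hG : G.IsUniform r) (hHf : H.vertexSet.Finite) (t : ℂ) :
    matchSum (G.disjUnion H).edgeSet t = matchSum G.edgeSet t * matchSum H.edgeSet t := by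
  have h1 := matchSum_image (Sum.inl_injective (α := α) (β := β)) G.edgeSet t
  have h2 := matchSum_image (Sum.inr_injective (α := α) (β := β)) H.edgeSet t
  rw [← h1, ← h2]
  refine matchSum_union ((edgeSet_finite hGf).image _) ((edgeSet_finite hHf).image _) ?_ ?_ t
  · rintro _ ⟨e, he, rfl⟩
    exact (hG.edge_nonempty hr he).image _
  · rintro _ ⟨e, -, rfl⟩ _ ⟨f, -, rfl⟩
    exact Set.disjoint_image_inl_image_inr

/-- The subhypergraph with the same vertices whose edges are those satisfying `P`. -/
def filterEdges (G : Hypergraph α) (P : Set α → Prop) : Hypergraph α where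
  vertexSet := G.vertexSet
  edgeSet := {e ∈ G.edgeSet | P e}
  subset_vertexSet_of_mem_edgeSet' _ he := subset_vertexSet_of_mem_edgeSet he.1

theorem matchSum_iUnion_image {m : ℕ} {G : Fin m → Hypergraph α} {r : ℕ} (hr : 1 ≤ r)
    (hGf : ∀ i, (G i).vertexSet.Finite) (hG : ∀ i, (G i).IsUniform r) (t : ℂ) :
    matchSum (⋃ i, Set.image (Prod.mk i) '' (G i).edgeSet) t =
      ∏ i, matchSum (G i).edgeSet t := by
  have h := matchSum_biUnion (E := fun i : Fin m => Set.image (Prod.mk i) '' (G i).edgeSet)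
    (fun i => (edgeSet_finite (hGf i)).image _)
    (by
      rintro i _ ⟨e, he, rfl⟩
      exact ((hG i).edge_nonempty hr he).image _)
    (by
      rintro i j hij _ ⟨e, -, rfl⟩ _ ⟨f, -, rfl⟩
      rw [Set.disjoint_left]
      rintro _ ⟨a, -, rfl⟩ ⟨b, -, hb⟩
      exact hij (congrArg Prod.fst hb).symm) Finset.univ t
  simp only [Finset.mem_univ, Set.iUnion_true] at h
  rw [h]
  exact Finset.prod_congr rfl fun i _ => matchSum_image (Prod.mk_right_injective i) _ t

theorem matchSum_copies {G : Hypergraph α} {r : ℕ} (hr : 1 ≤ r)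
    (hGf : G.vertexSet.Finite) (hG : G.IsUniform r) (m : ℕ) (t : ℂ) :
    matchSum (G.copies m).edgeSet t = matchSum G.edgeSet t ^ m := by
  refine (matchSum_iUnion_image (G := fun _ : Fin m => G) hr (fun _ => hGf) (fun _ => hG) t).trans ?_
  simp

/-- The new edges all meet in `u`. Choosing the `i`-th one excludes the edges of `G` at `u` and
those of the `i`-th copy of `H` at `v`, and leaves the other copies free. -/
theorem matchSum_attach {r m : ℕ} (hr : 1 ≤ r) {G : Hypergraph α} {H : Hypergraph β}
    (u : G.vertexSet) (v : H.vertexSet)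
    (hGf : G.vertexSet.Finite) (hG : G.IsUniform r) (hHf : H.vertexSet.Finite)
    (hH : H.IsUniform r) (t : ℂ) :
    matchSum (G.attach r m u H v).edgeSet t =
      matchSum G.edgeSet t * matchSum H.edgeSet t ^ m +
        m * (t * (matchSum {e ∈ G.edgeSet | u.1 ∉ e} t * (matchSum {e ∈ H.edgeSet | v.1 ∉ e} t *
          matchSum H.edgeSet t ^ (m - 1)))) := by
  classical
  have hfin : (G.disjUnion ((copies m H).disjUnion
      (trivialOn (Set.univ : Set (Fin m × Fin (r - 2)))))).edgeSet.Finite :=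
    edgeSet_finite (disjUnion_finite hGf (disjUnion_finite (copies_finite hHf m) Set.finite_univ))
  rw [attach_edgeSet]
  have h := matchSum_union_of_pairwise_not_disjoint hfin
    (newEdge_notMem (r := r) (G := G) (H := H) (u := u) (v := v) (m := m))
    (newEdge_injective r m u.1 v.1)
    (fun i j hd => (show Sum.inl u.1 ∉ newEdge r m u.1 v.1 j from
      Set.disjoint_left.1 hd (by simp)) (by simp)) Finset.univ t
  rw [Finset.coe_univ, Set.image_univ] at h
  rw [h, matchSum_disjUnion hr hGf hG (disjUnion_finite (copies_finite hHf m) Set.finite_univ),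
    matchSum_disjUnion hr (copies_finite hHf m) (hH.copies m) Set.finite_univ,
    matchSum_copies hr hHf hH, trivialOn_edgeSet, matchSum_empty, mul_one]
  congr 1
  have key : ∀ i : Fin m, matchSum {f ∈ (G.disjUnion ((copies m H).disjUnion
      (trivialOn (Set.univ : Set (Fin m × Fin (r - 2)))))).edgeSet |
        Disjoint f (newEdge r m u.1 v.1 i)} t =
      matchSum {e ∈ G.edgeSet | u.1 ∉ e} t * (matchSum {e ∈ H.edgeSet | v.1 ∉ e} t *
          matchSum H.edgeSet t ^ (m - 1)) := by
    intro i
    -- A family of copies in which only the `i`-th loses its edges at `v`, so that the product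
    -- formula over copies still applies.
    set H' : Fin m → Hypergraph β := fun j => H.filterEdges fun e => j = i → v.1 ∉ e with hH'
    have hGu : ∀ e : Set α, Disjoint (Sum.inl '' e) (newEdge r m u.1 v.1 i) ↔ u.1 ∉ e := by
      intro e
      rw [Set.disjoint_left]
      constructor
      · intro h hu
        exact h ⟨_, hu, rfl⟩ (by simp)
      · rintro h _ ⟨a, ha, rfl⟩ ha'
        rw [inl_mem_newEdge] at ha'
        exact h (ha' ▸ ha)
    have hHv : ∀ (j : Fin m) (e : Set β), Disjoint (Sum.inr '' (Sum.inl '' (Prod.mk j '' e)))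
        (newEdge r m u.1 v.1 i) ↔ (j = i → v.1 ∉ e) := by
      intro j e
      rw [Set.disjoint_left]
      constructor
      · rintro h rfl hv
        exact h ⟨_, ⟨_, ⟨_, hv, rfl⟩, rfl⟩, rfl⟩ (by simp)
      · rintro h _ ⟨_, ⟨_, ⟨a, ha, rfl⟩, rfl⟩, rfl⟩ ha'
        rw [inr_inl_mem_newEdge, Prod.mk.injEq] at ha'
        exact h ha'.1 (ha'.2 ▸ ha)
    have hset : {f ∈ (G.disjUnion ((copies m H).disjUnion
        (trivialOn (Set.univ : Set (Fin m × Fin (r - 2)))))).edgeSet |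
          Disjoint f (newEdge r m u.1 v.1 i)} =
        Set.image Sum.inl '' (G.filterEdges fun e => u.1 ∉ e).edgeSet ∪
          Set.image Sum.inr '' (Set.image Sum.inl ''
            ⋃ j, Set.image (Prod.mk j) '' (H' j).edgeSet) := by
      ext f
      constructor
      · rintro ⟨⟨e, he, rfl⟩ | ⟨_, ⟨_, he, rfl⟩ | ⟨_, he, -⟩, rfl⟩, hd⟩
        · exact Or.inl ⟨e, ⟨he, (hGu e).1 hd⟩, rfl⟩
        · obtain ⟨j, e, he', rfl⟩ := Set.mem_iUnion.1 he
          exact Or.inr ⟨_, ⟨_, Set.mem_iUnion.2 ⟨j, e, ⟨he', (hHv j e).1 hd⟩, rfl⟩, rfl⟩, rfl⟩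
        · exact he.elim
      · rintro (⟨e, ⟨he, hd⟩, rfl⟩ | ⟨_, ⟨_, he, rfl⟩, rfl⟩)
        · exact ⟨Or.inl ⟨e, he, rfl⟩, (hGu e).2 hd⟩
        · obtain ⟨j, e, ⟨he', hd⟩, rfl⟩ := Set.mem_iUnion.1 he
          exact ⟨Or.inr ⟨_, Or.inl ⟨_, Set.mem_iUnion.2 ⟨j, e, he', rfl⟩, rfl⟩, rfl⟩,
            (hHv j e).2 hd⟩
    have hH'f : ∀ j, (H' j).vertexSet.Finite := fun _ => hHf
    have hH'u : ∀ j, (H' j).IsUniform r := fun _ e he => hH e he.1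
    have hH'i : (H' i).edgeSet = {e ∈ H.edgeSet | v.1 ∉ e} := by
      simp [hH', filterEdges]
    have hH'j : ∀ j, j ≠ i → (H' j).edgeSet = H.edgeSet := by
      intro j hj
      simp [hH', filterEdges, hj]
    rw [hset, matchSum_union, matchSum_image Sum.inl_injective, matchSum_image Sum.inr_injective,
      matchSum_image Sum.inl_injective, matchSum_iUnion_image hr hH'f hH'u,
      ← Finset.mul_prod_erase _ _ (Finset.mem_univ i), hH'i,
      Finset.prod_congr rfl fun j hj => by rw [hH'j j (Finset.ne_of_mem_erase hj)],
      Finset.prod_const, Finset.card_erase_of_mem (Finset.mem_univ i), Finset.card_univ,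
      Fintype.card_fin]
    · rfl
    · exact ((edgeSet_finite hGf).subset fun _ h => h.1).image _
    · exact (((Set.finite_iUnion fun j => (edgeSet_finite (hH'f j)).image _)).image _).image _
    · rintro _ ⟨e, he, rfl⟩
      exact (hG.edge_nonempty hr he.1).image _
    · rintro _ ⟨e, -, rfl⟩ _ ⟨f, -, rfl⟩
      exact Set.disjoint_image_inl_image_inr
  rw [Finset.sum_congr rfl fun i _ => by rw [key i], Finset.sum_const, Finset.card_univ,
    Fintype.card_fin, nsmul_eq_mul]

theorem ncard_vertexSet_disjUnion {G : Hypergraph α} {H : Hypergraph β}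
    (hG : G.vertexSet.Finite) (hH : H.vertexSet.Finite) :
    (G.disjUnion H).vertexSet.ncard = G.vertexSet.ncard + H.vertexSet.ncard := by
  refine (Set.ncard_union_eq Set.disjoint_image_inl_image_inr (hG.image _) (hH.image _)).trans ?_
  rw [Set.ncard_image_of_injective _ Sum.inl_injective,
    Set.ncard_image_of_injective _ Sum.inr_injective]

theorem ncard_vertexSet_copies (G : Hypergraph α) (m : ℕ) :
    (G.copies m).vertexSet.ncard = m * G.vertexSet.ncard := by
  have : (G.copies m).vertexSet = (Set.univ : Set (Fin m)) ×ˢ G.vertexSet := by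
    ext ⟨i, a⟩
    simp [mem_copies]
  rw [this, Set.ncard_prod, Set.ncard_univ, Nat.card_eq_fintype_card, Fintype.card_fin]

theorem ncard_vertexSet_attach {r m : ℕ} {G : Hypergraph α} {H : Hypergraph β}
    (u : G.vertexSet) (v : H.vertexSet) (hG : G.vertexSet.Finite) (hH : H.vertexSet.Finite) :
    (G.attach r m u H v).vertexSet.ncard =
      G.vertexSet.ncard + (m * H.vertexSet.ncard + m * (r - 2)) := by
  rw [attach_vertexSet, ncard_vertexSet_disjUnion hG
    (disjUnion_finite (copies_finite hH m) Set.finite_univ),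
    ncard_vertexSet_disjUnion (copies_finite hH m) Set.finite_univ, ncard_vertexSet_copies]
  simp [Set.ncard_univ]

/-- Both generating functions equal $(M_{\mathcal G}M_{\mathcal H})^m+mt\,M_{\mathcal
G-u}M_{\mathcal H-v}(M_{\mathcal G}M_{\mathcal H})^{m-1}$, and both vertex numbers equal
$m(|\mathcal G|+|\mathcal H|+r-2)$. -/
theorem matchingPolynomial_attach_disjUnion_copies {r m : ℕ} (hr : 2 ≤ r) (hm : 1 ≤ m)
    {G : Hypergraph α} {H : Hypergraph β} (u : G.vertexSet) (v : H.vertexSet)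
    (hGf : G.vertexSet.Finite) (hG : G.IsUniform r) (hHf : H.vertexSet.Finite)
    (hH : H.IsUniform r) :
    matchingPolynomial r ((G.attach r m u H v).disjUnion (G.copies (m - 1))) =
      matchingPolynomial r ((H.attach r m v G u).disjUnion (H.copies (m - 1))) := by
  refine matchingPolynomial_eq (by omega) (disjUnion_finite (attach_finite hGf hHf)
    (copies_finite hGf _)) ((attach_isUniform hr hG hH).disjUnion (hG.copies _))
    (disjUnion_finite (attach_finite hHf hGf) (copies_finite hHf _))
    ((attach_isUniform hr hH hG).disjUnion (hH.copies _)) ?_ fun t => ?_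
  · rw [ncard_vertexSet_disjUnion (attach_finite hGf hHf) (copies_finite hGf _),
      ncard_vertexSet_disjUnion (attach_finite hHf hGf) (copies_finite hHf _),
      ncard_vertexSet_attach u v hGf hHf, ncard_vertexSet_attach v u hHf hGf,
      ncard_vertexSet_copies, ncard_vertexSet_copies]
    obtain ⟨k, rfl⟩ : ∃ k, m = k + 1 := ⟨m - 1, by omega⟩
    rw [Nat.add_sub_cancel]
    ring
  · rw [matchSum_disjUnion (by omega) (attach_finite hGf hHf) (attach_isUniform hr hG hH)
        (copies_finite hGf _),
      matchSum_disjUnion (by omega) (attach_finite hHf hGf) (attach_isUniform hr hH hG)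
        (copies_finite hHf _),
      matchSum_attach (by omega) u v hGf hG hHf hH, matchSum_attach (by omega) v u hHf hH hGf hG,
      matchSum_copies (by omega) hGf hG, matchSum_copies (by omega) hHf hH]
    obtain ⟨k, rfl⟩ : ∃ k, m = k + 1 := ⟨m - 1, by omega⟩
    rw [Nat.add_sub_cancel]
    ring

end Hypergraph

theorem theorem4p2 {α β : Type*} (r m : ℕ) (hr : 3 ≤ r) (hm : 1 ≤ m)
    (G : Hypergraph α) (H : Hypergraph β) (hG : G.IsSupertree r) (hH : H.IsSupertree r)
    (u : G.vertexSet) (v : H.vertexSet) :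
    Hypergraph.spectralRadius r ((G.attach r m u H v).disjUnion (G.copies (m - 1))) =
        Hypergraph.spectralRadius r ((H.attach r m v G u).disjUnion (H.copies (m - 1))) ∧
      Hypergraph.spectralRadius r (G.attach r m u H v) =
        Hypergraph.spectralRadius r (H.attach r m v G u) ∧
      Hypergraph.matchingEnergy r ((G.attach r m u H v).disjUnion (G.copies (m - 1))) =
        Hypergraph.matchingEnergy r ((H.attach r m v G u).disjUnion (H.copies (m - 1))) := by
  -- $c=m^{-1/r}$ depends only on `m` and `r`, so the same joining weight $m^{1/r}$ serves both
  -- constructions.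
  obtain ⟨c, hc, hcm⟩ : ∃ c : ℝ, 0 < c ∧ m * c ^ r = 1 := by
    have hm' : (0 : ℝ) < m := by exact_mod_cast hm
    refine ⟨(m : ℝ)⁻¹ ^ (r : ℝ)⁻¹, by positivity, ?_⟩
    rw [Real.rpow_inv_natCast_pow (by positivity) (by omega), mul_inv_cancel₀ hm'.ne']
  obtain ⟨l, p, q, z, h⟩ := Hypergraph.exists_isJoinEigenvector (by omega : 2 ≤ r) hG.finite
    hG.uniform hG.connected hH.finite hH.uniform hH.connected u v (inv_pos.2 hc)
  refine ⟨?_, ?_, ?_⟩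
  · rw [h.spectralRadius_attach_disjUnion hr hG.finite hG.uniform hH.finite hH.uniform hc hcm,
      h.symm.spectralRadius_attach_disjUnion hr hH.finite hH.uniform hG.finite hG.uniform hc hcm]
  · rw [h.spectralRadius_attach hr hG.finite hG.uniform hH.finite hH.uniform hc hcm,
      h.symm.spectralRadius_attach hr hH.finite hH.uniform hG.finite hG.uniform hc hcm]
  · rw [Hypergraph.matchingEnergy, Hypergraph.matchingPolynomial_attach_disjUnion_copies
      (by omega) hm u v hG.finite hG.uniform hH.finite hH.uniform, Hypergraph.matchingEnergy]
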